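/- Let $n\ge 2$ and let $A_o(n)$ be the free orthogonal quantum group: the unital complex $*$-algebra generated by self-adjoint elements $u_{ij}$, $1\le i,j\le n$, with relations $\sum_{j} u_{ij}u_{kj}=\delta_{ik}$ and $\sum_{j} u_{ji}u_{jk}=\delta_{ik}$ for all $i,k$. Let $\varepsilon\colon A_o(n)\to\mathbb{C}$ be its counit, the unital algebra morphism with $\varepsilon(u_{ij})=\delta_{ij}$, and regard $\mathbb{C}$ as a left $A_o(n)$-module through $\varepsilon$. Let $M_nA_o(n)=A_o(n)\otimes_{\mathbb{C}}M_n(\mathbb{C})$, a free left $A_o(n)$-module on the matrix units $e_{ij}=1\otimes e_{ij}$, and put $r_{ik}=1\otimes e_{ik}+\sum_j u_{ij}\otimes e_{kj}\in M_nA_o(n)$. Then the sequence of left $A_o(n)$-modules $$0\to A_o(n)\xrightarrow{\ \phi_1\ } M_nA_o(n)\xrightarrow{\ \phi_2\ } M_nA_o(n)\xrightarrow{\ \phi_3\ } A_o(n)\xrightarrow{\ \varepsilon\ }\mathbb{C}\to 0,$$ where $\phi_1,\phi_2,\phi_3$ are the $A_o(n)$-linear maps with $$\phi_1(1)=\sum_{i,j}(u_{ij}-\delta_{ij})\otimes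 e_{ij},\qquad \phi_2(e_{ij})=r_{ij},\qquad \phi_3(e_{ij})=u_{ij}-\delta_{ij},$$ is exact; hence it is a free resolution of the trivial module $\mathbb{C}$ given by the counit. -/

import Mathlib

open scoped TensorProduct

/-- The defining relations of the free orthogonal quantum group, on the free unital complex algebra
on the symbols `u i j`: `∑ j, u i j * u k j = δ i k` and `∑ j, u j i * u j k = δ i k`. -/
inductive AoRel (n : ℕ) :
    FreeAlgebra ℂ (Fin n × Fin n) → FreeAlgebra ℂ (Fin n × Fin n) → Prop
  | row (i k : Fin n) : AoRel n
      (∑ j : Fin n, FreeAlgebra.ι ℂ (i, j) * FreeAlgebra.ι ℂ (k, j)) (if i = k then 1 else 0)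
  | col (i k : Fin n) : AoRel n
      (∑ j : Fin n, FreeAlgebra.ι ℂ (j, i) * FreeAlgebra.ι ℂ (j, k)) (if i = k then 1 else 0)

/-- The free orthogonal quantum group `A_o(n)`, as a unital complex algebra. Its involution, for
which the generators are self-adjoint, is constructed below, together with the universal property
of `A_o(n)` among unital `*`-algebras. -/
abbrev Ao (n : ℕ) : Type := RingQuot (AoRel n)

namespace Ao

/-- The canonical generators `u i j` of `A_o(n)`. -/
noncomputable def u {n : ℕ} (i j : Fin n) : Ao n :=
  RingQuot.mkAlgHom ℂ (AoRel n) (FreeAlgebra.ι ℂ (i, j))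

theorem row_rel {n : ℕ} (i k : Fin n) :
    ∑ j : Fin n, u i j * u k j = if i = k then (1 : Ao n) else 0 := by
  have h := RingQuot.mkAlgHom_rel ℂ (AoRel.row i k)
  rw [apply_ite (RingQuot.mkAlgHom ℂ (AoRel n))] at h
  simpa [u] using h

theorem col_rel {n : ℕ} (i k : Fin n) :
    ∑ j : Fin n, u j i * u j k = if i = k then (1 : Ao n) else 0 := by
  have h := RingQuot.mkAlgHom_rel ℂ (AoRel.col i k)
  rw [apply_ite (RingQuot.mkAlgHom ℂ (AoRel n))] at h
  simpa [u] using h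

/-- The algebra morphism out of `A_o(n)` given by a family satisfying the defining relations. -/
noncomputable def lift {n : ℕ} {B : Type*} [Ring B] [Algebra ℂ B] (v : Fin n → Fin n → B)
    (hrow : ∀ i k, ∑ j : Fin n, v i j * v k j = if i = k then 1 else 0)
    (hcol : ∀ i k, ∑ j : Fin n, v j i * v j k = if i = k then 1 else 0) : Ao n →ₐ[ℂ] B :=
  RingQuot.liftAlgHom ℂ ⟨FreeAlgebra.lift ℂ (fun p : Fin n × Fin n => v p.1 p.2), by
    intro a b h
    cases h with
    | row i k => rw [apply_ite (FreeAlgebra.lift ℂ _)]; simpa using hrow i k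
    | col i k => rw [apply_ite (FreeAlgebra.lift ℂ _)]; simpa using hcol i k⟩

@[simp] theorem lift_u {n : ℕ} {B : Type*} [Ring B] [Algebra ℂ B] (v : Fin n → Fin n → B)
    (hrow : ∀ i k, ∑ j : Fin n, v i j * v k j = if i = k then 1 else 0)
    (hcol : ∀ i k, ∑ j : Fin n, v j i * v j k = if i = k then 1 else 0) (i j : Fin n) :
    lift v hrow hcol (u i j) = v i j := by
  simp [lift, u]

theorem induction {n : ℕ} {P : Ao n → Prop} (hs : ∀ c : ℂ, P (algebraMap ℂ (Ao n) c))
    (hu : ∀ i j, P (u i j)) (hm : ∀ a b, P a → P b → P (a * b))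
    (ha : ∀ a b, P a → P b → P (a + b)) (a : Ao n) : P a := by
  obtain ⟨x, rfl⟩ := RingQuot.mkAlgHom_surjective ℂ (AoRel n) a
  induction x using FreeAlgebra.induction with
  | grade0 c => simpa using hs c
  | grade1 p => exact hu p.1 p.2
  | mul a b h1 h2 => simpa using hm _ _ h1 h2
  | add a b h1 h2 => simpa using ha _ _ h1 h2

/-- The involution of `A_o(n)` as a ring morphism into the opposite ring: it is obtained from the
complex algebra structure on the opposite ring in which scalars act through their conjugates. -/
noncomputable def starHom (n : ℕ) : Ao n →+* (Ao n)ᵐᵒᵖ :=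
  letI : Algebra ℂ (Ao n)ᵐᵒᵖ := Algebra.compHom (Ao n)ᵐᵒᵖ (starRingEnd ℂ)
  (lift (B := (Ao n)ᵐᵒᵖ) (fun i j => MulOpposite.op (u i j))
    (fun i k => by
      have h := congrArg MulOpposite.op (row_rel k i)
      simp only [← MulOpposite.op_mul, ← Finset.op_sum, h]
      by_cases e : i = k
      · subst e; simp
      · rw [if_neg e, if_neg (Ne.symm e), MulOpposite.op_zero])
    (fun i k => by
      have h := congrArg MulOpposite.op (col_rel k i)
      simp only [← MulOpposite.op_mul, ← Finset.op_sum, h]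
      by_cases e : i = k
      · subst e; simp
      · rw [if_neg e, if_neg (Ne.symm e), MulOpposite.op_zero])).toRingHom

theorem starHom_u {n : ℕ} (i j : Fin n) : starHom n (u i j) = MulOpposite.op (u i j) := by
  let _ : Algebra ℂ (Ao n)ᵐᵒᵖ := Algebra.compHom (Ao n)ᵐᵒᵖ (starRingEnd ℂ)
  exact lift_u (B := (Ao n)ᵐᵒᵖ) _ _ _ i j

theorem starHom_algebraMap {n : ℕ} (c : ℂ) :
    starHom n (algebraMap ℂ (Ao n) c) = MulOpposite.op (algebraMap ℂ (Ao n) (star c)) := by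
  let _ : Algebra ℂ (Ao n)ᵐᵒᵖ := Algebra.compHom (Ao n)ᵐᵒᵖ (starRingEnd ℂ)
  exact AlgHom.commutes (lift (B := (Ao n)ᵐᵒᵖ) (fun i j => MulOpposite.op (u i j)) _ _) c

noncomputable instance instStarRing (n : ℕ) : StarRing (Ao n) where
  star a := (starHom n a).unop
  star_involutive a := by
    induction a using Ao.induction with
    | hs c => simp [starHom_algebraMap]
    | hu i j => simp [starHom_u]
    | hm a b h1 h2 => simp_all
    | ha a b h1 h2 => simp_all
  star_mul a b := by simp
  star_add a b := by simp

theorem star_u {n : ℕ} (i j : Fin n) : star (u i j : Ao n) = u i j :=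
  congrArg MulOpposite.unop (starHom_u i j)

theorem star_algebraMap {n : ℕ} (c : ℂ) :
    star (algebraMap ℂ (Ao n) c) = algebraMap ℂ (Ao n) (star c) :=
  congrArg MulOpposite.unop (starHom_algebraMap c)

instance instStarModule (n : ℕ) : StarModule ℂ (Ao n) where
  star_smul c a := by
    rw [Algebra.smul_def, star_mul, star_algebraMap, Algebra.smul_def, Algebra.commutes]

/-- `A_o(n)` is the universal unital `*`-algebra generated by self-adjoint elements subject to the
defining relations. -/
theorem existsUnique_starAlgHom {n : ℕ} {B : Type*} [Ring B] [StarRing B] [Algebra ℂ B]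
    [StarModule ℂ B] (v : Fin n → Fin n → B) (hv : ∀ i j, star (v i j) = v i j)
    (hrow : ∀ i k, ∑ j : Fin n, v i j * v k j = if i = k then 1 else 0)
    (hcol : ∀ i k, ∑ j : Fin n, v j i * v j k = if i = k then 1 else 0) :
    ∃! f : Ao n →⋆ₐ[ℂ] B, ∀ i j, f (u i j) = v i j := by
  refine ⟨⟨lift v hrow hcol, fun a => ?_⟩, fun i j => lift_u v hrow hcol i j, fun g hg => ?_⟩
  · change lift v hrow hcol (star a) = star (lift v hrow hcol a)
    induction a using Ao.induction with
    | hs c => rw [star_algebraMap, AlgHom.commutes, AlgHom.commutes, algebraMap_star_comm]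
    | hu i j => rw [star_u, lift_u, hv]
    | hm a b h1 h2 => simp [h1, h2]
    | ha a b h1 h2 => simp [h1, h2]
  · ext a
    change g a = lift v hrow hcol a
    induction a using Ao.induction with
    | hs c => rw [AlgHom.commutes]; exact AlgHomClass.commutes g c
    | hu i j => rw [lift_u, hg]
    | hm a b h1 h2 => simp [h1, h2]
    | ha a b h1 h2 => simp [h1, h2]

/-- The counit `ε : A_o(n) → ℂ`, the algebra morphism with `ε (u i j) = δ i j`. -/
noncomputable def counit (n : ℕ) : Ao n →ₐ[ℂ] ℂ :=
  lift (fun i j => if i = j then 1 else 0)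
    (fun i k => by simp)
    (fun i k => by simp; exact if_congr eq_comm rfl rfl)

theorem counit_u {n : ℕ} (i j : Fin n) : counit n (u i j) = if i = j then 1 else 0 := by
  simp [counit]

/-- The trivial left `A_o(n)`-module: `ℂ`, on which `A_o(n)` acts through the counit. -/
def Triv (_n : ℕ) : Type := ℂ

noncomputable instance (n : ℕ) : AddCommGroup (Triv n) := inferInstanceAs (AddCommGroup ℂ)

noncomputable instance (n : ℕ) : Module (Ao n) (Triv n) :=
  Module.compHom ℂ (counit n).toRingHom

/-- The counit, as a morphism of left `A_o(n)`-modules onto the trivial module. -/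
noncomputable def ε (n : ℕ) : Ao n →ₗ[Ao n] Triv n where
  toFun a := (counit n a : ℂ)
  map_add' := map_add (counit n)
  map_smul' := map_mul (counit n)

/-- `M_n A_o(n)`, the algebraic tensor product of `A_o(n)` and the complex `n × n` matrices, a left
`A_o(n)`-module through the factor `A_o(n)`. -/
abbrev MatAo (n : ℕ) : Type := Ao n ⊗[ℂ] Matrix (Fin n) (Fin n) ℂ

/-- The elementary tensor `a ⊗ e i j`, where `e i j` is a matrix unit. -/
noncomputable def te {n : ℕ} (a : Ao n) (i j : Fin n) : MatAo n :=
  a ⊗ₜ[ℂ] Matrix.single i j (1 : ℂ)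

/-- The elements `1 ⊗ e i j` form a basis of the left `A_o(n)`-module `M_n A_o(n)`. -/
noncomputable def matBasis (n : ℕ) : Module.Basis (Fin n × Fin n) (Ao n) (MatAo n) :=
  Algebra.TensorProduct.basis (Ao n) (Matrix.stdBasis ℂ (Fin n) (Fin n))

theorem matBasis_apply {n : ℕ} (i j : Fin n) : matBasis n (i, j) = te 1 i j := by
  simp [matBasis, te, Matrix.stdBasis_eq_single]

/-- `r i k = 1 ⊗ e i k + ∑ j, u i j ⊗ e k j`. -/
noncomputable def r {n : ℕ} (i k : Fin n) : MatAo n :=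
  te 1 i k + ∑ j : Fin n, te (u i j) k j

/-- The generator minus its counit, `u i j - δ i j`. -/
noncomputable def du {n : ℕ} (i j : Fin n) : Ao n := u i j - if i = j then 1 else 0

/-- The module morphism with `φ₁ 1 = ∑ i j, (u i j - δ i j) ⊗ e i j`. -/
noncomputable def φ₁ (n : ℕ) : Ao n →ₗ[Ao n] MatAo n :=
  LinearMap.toSpanSingleton (Ao n) (MatAo n) (∑ i : Fin n, ∑ j : Fin n, te (du i j) i j)

/-- The module morphism with `φ₂ (1 ⊗ e i j) = r i j`. -/
noncomputable def φ₂ (n : ℕ) : MatAo n →ₗ[Ao n] MatAo n :=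
  (matBasis n).constr ℂ (fun p => r p.1 p.2)

/-- The module morphism with `φ₃ (1 ⊗ e i j) = u i j - δ i j`. -/
noncomputable def φ₃ (n : ℕ) : MatAo n →ₗ[Ao n] Ao n :=
  (matBasis n).constr ℂ (fun p => du p.1 p.2)

theorem φ₁_one (n : ℕ) : φ₁ n 1 = ∑ i : Fin n, ∑ j : Fin n, te (du i j) i j := by
  simp [φ₁]

theorem φ₂_te {n : ℕ} (i j : Fin n) : φ₂ n (te 1 i j) = r i j := by
  rw [← matBasis_apply, φ₂, Module.Basis.constr_basis]

theorem φ₃_te {n : ℕ} (i j : Fin n) : φ₃ n (te 1 i j) = du i j := by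
  rw [← matBasis_apply, φ₃, Module.Basis.constr_basis]

end Ao

/-! In coordinates `φ₁` is `b ↦ b(u - 1)`, `φ₂` is `X ↦ X + Xᵗu` and `φ₃` is `X ↦ ∑ X i k (u i k - δ
i k)`. The right end is formal. The elements `u i j - δ i j` generate the kernel of the counit as a
left ideal, and a derivation from `A_o(n)` to the cokernel of `φ₂`, sending `u i j` to the class of
`e i j`, inverts `φ₃` modulo the range of `φ₂` (`deriv_φ₃`).

The left end needs a normal form in `A_o(n)`. Let `J` be the permutation matrix of a transposition
`bot ↔ top` of indices. Conjugation by a symmetric complex square root of `J` turns the relations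
into `v J vᵗ = J = vᵗ J v`. Solved for their `top` terms, these rewrite the products `v i top * v k
bot` and `v top i * v bot k`; the only product that two relations rewrite is `v top top * v bot
bot`. Words without such factors are normal. Right multiplication by letters is defined on their
span by recursion on length, and the relations are verified there (`rowAt_colAt`), so the normal
words form a basis of the algebra.

With this basis the coefficient of a last letter can be read off from sums such as `∑ f m * v k m`.
A solution of `X + Xᵗu = 0` then agrees in top degree with some `b(u - 1)`; subtracting it lowers
the degree (`exists_eq_mul_sub`). Injectivity of `φ₁` holds because right multiplication by `v top
top` merely appends a letter (`eq_zero_of_mul_gen_eq`). -/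

/-- An involution `inv` of an index set, with a chosen element `bot` that it moves. -/
structure IndexPairing (I : Type*) where
  inv : I → I
  inv_inv : ∀ i, inv (inv i) = i
  bot : I
  inv_bot_ne : inv bot ≠ bot

/-- The vector space on the words in the letters `I × I`. A word is stored as a list whose head is
its last letter. -/
abbrev WordSpace (I : Type*) : Type _ := List (I × I) →₀ ℂ

/-! ### Words, normal words and their evaluation. -/

namespace IndexPairing

variable {I : Type*}

section basics

variable (P : IndexPairing I)

/-- The partner of `bot`. -/
def top : I := P.inv P.bot

theorem inv_bot : P.inv P.bot = P.top := rfl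

theorem inv_top : P.inv P.top = P.bot := P.inv_inv _

theorem top_ne_bot : P.top ≠ P.bot := P.inv_bot_ne

theorem inv_inj {i j : I} : P.inv i = P.inv j ↔ i = j :=
  ⟨fun h => by rw [← P.inv_inv i, h, P.inv_inv], fun h => h ▸ rfl⟩

theorem inv_eq_iff {i j : I} : P.inv i = j ↔ i = P.inv j :=
  ⟨fun h => by rw [← h, P.inv_inv], fun h => by rw [h, P.inv_inv]⟩

theorem inv_ne_bot {i : I} (h : i ≠ P.top) : P.inv i ≠ P.bot :=
  fun e => h (by rw [← P.inv_bot, ← e, P.inv_inv])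

theorem sum_inv [Fintype I] {M : Type*} [AddCommMonoid M] (f : I → M) :
    ∑ i, f (P.inv i) = ∑ i, f i :=
  Equiv.sum_comp (Function.Involutive.toPerm P.inv P.inv_inv) f

/-- The relations of the quantum group of the bilinear form given by the permutation matrix
of `inv`. -/
structure Rel [Fintype I] [DecidableEq I] {A : Type*} [Ring A] (v : I → I → A) : Prop where
  row : ∀ i k, ∑ j, v i j * v k (P.inv j) = if i = P.inv k then 1 else 0
  col : ∀ i k, ∑ j, v j i * v (P.inv j) k = if i = P.inv k then 1 else 0

/-- The letter `x` may follow the word `w`. -/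
def Allowed (x : I × I) (w : List (I × I)) : Prop :=
  ∀ y ∈ w.head?, ¬(y.1 = P.top ∧ x.1 = P.bot) ∧ ¬(y.2 = P.top ∧ x.2 = P.bot)

/-- The words without a factor `(p, top) (k, bot)` or `(top, m) (bot, q)`. -/
def Normal (P : IndexPairing I) : List (I × I) → Prop
  | [] => True
  | x :: w => P.Allowed x w ∧ Normal P w

@[simp] theorem allowed_nil (x : I × I) : P.Allowed x [] := by simp [Allowed]

@[simp] theorem allowed_cons (x y : I × I) (w : List (I × I)) : P.Allowed x (y :: w) ↔
    ¬(y.1 = P.top ∧ x.1 = P.bot) ∧ ¬(y.2 = P.top ∧ x.2 = P.bot) := by simp [Allowed]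

@[simp] theorem normal_nil : P.Normal [] := trivial

@[simp] theorem normal_cons (x : I × I) (w : List (I × I)) :
    P.Normal (x :: w) ↔ P.Allowed x w ∧ P.Normal w := Iff.rfl

theorem allowed_of_ne {x : I × I} (h1 : x.1 ≠ P.bot) (h2 : x.2 ≠ P.bot) (w : List (I × I)) :
    P.Allowed x w := fun _ _ => ⟨fun h => h1 h.2, fun h => h2 h.2⟩

end basics

/-- A word, as a basis vector. -/
noncomputable def word (w : List (I × I)) : WordSpace I := Finsupp.single w 1

/-- Appending a letter. -/
noncomputable def app (x : I × I) : WordSpace I →ₗ[ℂ] WordSpace I :=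
  Finsupp.lmapDomain ℂ ℂ (List.cons x)

@[simp] theorem app_word (x : I × I) (w : List (I × I)) : app x (word w) = word (x :: w) := by
  simp [app, word]

/-- The linear map with given values on the words. -/
noncomputable def ofWords {M : Type*} [AddCommGroup M] [Module ℂ M] (f : List (I × I) → M) :
    WordSpace I →ₗ[ℂ] M := Finsupp.linearCombination ℂ f

@[simp] theorem ofWords_word {M : Type*} [AddCommGroup M] [Module ℂ M] (f : List (I × I) → M)
    (w : List (I × I)) : ofWords f (word w) = f w := by
  simp [ofWords, word]

/-- The product of the letters of a word. -/
def wordProd {A : Type*} [Ring A] (v : I → I → A) : List (I × I) → A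
  | [] => 1
  | x :: w => wordProd v w * v x.1 x.2

/-- Evaluation of combinations of words. -/
noncomputable def evalWords {A : Type*} [Ring A] [Algebra ℂ A] (v : I → I → A) :
    WordSpace I →ₗ[ℂ] A := ofWords (wordProd v)

section eval

variable {A : Type*} [Ring A] [Algebra ℂ A] (v : I → I → A)

@[simp] theorem evalWords_nil : evalWords v (word []) = 1 := by simp [evalWords, wordProd]

@[simp] theorem evalWords_cons (x : I × I) (w : List (I × I)) :
    evalWords v (word (x :: w)) = evalWords v (word w) * v x.1 x.2 := by
  simp [evalWords, wordProd]

theorem evalWords_app (x : I × I) (a : WordSpace I) :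
    evalWords v (app x a) = evalWords v a * v x.1 x.2 := by
  have : evalWords v ∘ₗ app x = LinearMap.mulRight ℂ (v x.1 x.2) ∘ₗ evalWords v := by
    apply Finsupp.lhom_ext'
    intro w
    ext
    exact (congrArg _ (app_word x w)).trans (evalWords_cons v x w)
  exact LinearMap.congr_fun this a

end eval

variable (P : IndexPairing I)

/-- The span of the normal words of length less than `d`. -/
noncomputable def normalLT (d : ℕ) : Submodule ℂ (WordSpace I) :=
  Finsupp.supported ℂ ℂ {w | P.Normal w ∧ w.length < d}

/-- The span of the normal words. -/
noncomputable def normalSpan : Submodule ℂ (WordSpace I) :=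
  Finsupp.supported ℂ ℂ {w | P.Normal w}

variable {P}

theorem word_mem_normalLT {d : ℕ} {w : List (I × I)} (h : P.Normal w) (hd : w.length < d) :
    word w ∈ P.normalLT d := Finsupp.single_mem_supported _ _ ⟨h, hd⟩

theorem word_mem_normalSpan {w : List (I × I)} (h : P.Normal w) :
    word w ∈ P.normalSpan := Finsupp.single_mem_supported _ _ h

theorem normalLT_mono {d d' : ℕ} (h : d ≤ d') : P.normalLT d ≤ P.normalLT d' :=
  Finsupp.supported_mono fun _ hw => ⟨hw.1, hw.2.trans_le h⟩

theorem normalLT_le_normalSpan (d : ℕ) : P.normalLT d ≤ P.normalSpan :=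
  Finsupp.supported_mono fun _ hw => hw.1

theorem map_mem_of_words {M : Type*} [AddCommGroup M] [Module ℂ M] {s : Set (List (I × I))}
    (f : WordSpace I →ₗ[ℂ] M) (S : Submodule ℂ M) (h : ∀ w ∈ s, f (word w) ∈ S)
    {a : WordSpace I} (ha : a ∈ Finsupp.supported ℂ ℂ s) : f a ∈ S := by
  rw [Finsupp.supported_eq_span_single] at ha
  have : Submodule.span ℂ ((fun i => Finsupp.single i (1 : ℂ)) '' s) ≤ S.comap f := by
    rw [Submodule.span_le]
    rintro _ ⟨w, hw, rfl⟩
    exact h w hw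
  exact this ha

theorem map_eq_of_words {M : Type*} [AddCommGroup M] [Module ℂ M] {s : Set (List (I × I))}
    {f g : WordSpace I →ₗ[ℂ] M} (h : ∀ w ∈ s, f (word w) = g (word w))
    {a : WordSpace I} (ha : a ∈ Finsupp.supported ℂ ℂ s) : f a = g a := by
  have := map_mem_of_words (f - g) ⊥ (fun w hw => by simp [h w hw]) ha
  simpa [sub_eq_zero] using this

theorem map_eq_of_normalLT {M : Type*} [AddCommGroup M] [Module ℂ M] {d : ℕ}
    {f g : WordSpace I →ₗ[ℂ] M} (h : ∀ w, P.Normal w → w.length < d → f (word w) = g (word w))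
    {a : WordSpace I} (ha : a ∈ P.normalLT d) : f a = g a :=
  map_eq_of_words (fun w hw => h w hw.1 hw.2) ha

theorem map_eq_of_normalSpan {M : Type*} [AddCommGroup M] [Module ℂ M]
    {f g : WordSpace I →ₗ[ℂ] M} (h : ∀ w, P.Normal w → f (word w) = g (word w))
    {a : WordSpace I} (ha : a ∈ P.normalSpan) : f a = g a :=
  map_eq_of_words h ha

theorem app_mem_normalLT {x : I × I} (h1 : x.1 ≠ P.bot) (h2 : x.2 ≠ P.bot) {d : ℕ}
    {a : WordSpace I} (ha : a ∈ P.normalLT d) : app x a ∈ P.normalLT (d + 1) :=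
  map_mem_of_words _ _ (fun w hw => by
    rw [app_word]
    exact word_mem_normalLT ⟨P.allowed_of_ne h1 h2 w, hw.1⟩ (by simpa using hw.2)) ha

/-! ### The recursive rewriting of a normal word times a letter. -/

variable [Fintype I] [DecidableEq I]

/-- Right multiplication by the letter `(bot, q)`, `q ≠ bot`, on a word, in terms of the right
multiplications on the shorter words. -/
noncomputable def stepTop (P : IndexPairing I) (T : I → I → WordSpace I →ₗ[ℂ] WordSpace I) (q : I) :
    WordSpace I →ₗ[ℂ] WordSpace I :=
  ofWords fun w => match w with
    | [] => word [(P.bot, q)]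
    | x :: w => if x.1 = P.top then
        (if x.2 = P.inv q then word w else 0)
          - ∑ i ∈ Finset.univ.erase P.top, app (P.inv i, q) (T i x.2 (word w))
      else word ((P.bot, q) :: x :: w)

/-- Right multiplication by the letter `(p, bot)`, `p ≠ bot`, on a word, in terms of the right
multiplications on the shorter words. -/
noncomputable def stepLeft (P : IndexPairing I) (T : I → I → WordSpace I →ₗ[ℂ] WordSpace I)
    (p : I) : WordSpace I →ₗ[ℂ] WordSpace I :=
  ofWords fun w => match w with
    | [] => word [(p, P.bot)]
    | x :: w => if x.2 = P.top then
        (if x.1 = P.inv p then word w else 0)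
          - ∑ j ∈ Finset.univ.erase P.top, app (p, P.inv j) (T x.1 j (word w))
      else word ((p, P.bot) :: x :: w)

/-- Right multiplication by the letter `(bot, bot)` on a word, in terms of the right
multiplications on the shorter words. -/
noncomputable def stepCorner (P : IndexPairing I) (T : I → I → WordSpace I →ₗ[ℂ] WordSpace I) :
    WordSpace I →ₗ[ℂ] WordSpace I :=
  ofWords fun w => match w with
    | [] => word [(P.bot, P.bot)]
    | x :: w => if x.2 = P.top then
        (if x.1 = P.top then word w else 0)
          - ∑ j ∈ Finset.univ.erase P.top, P.stepTop T (P.inv j) (T x.1 j (word w))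
      else if x.1 = P.top then
        (if x.2 = P.top then word w else 0)
          - ∑ i ∈ Finset.univ.erase P.top, P.stepLeft T (P.inv i) (T i x.2 (word w))
      else word ((P.bot, P.bot) :: x :: w)

/-- Right multiplication by letters, in terms of the right multiplications on shorter words. -/
noncomputable def step (P : IndexPairing I) (T : I → I → WordSpace I →ₗ[ℂ] WordSpace I) (p q : I) :
    WordSpace I →ₗ[ℂ] WordSpace I :=
  if p = P.bot then (if q = P.bot then P.stepCorner T else P.stepTop T q)
  else if q = P.bot then P.stepLeft T p else app (p, q)

/-- `T` behaves on short normal words as right multiplication by letters does. -/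
def IsMul (P : IndexPairing I) {A : Type*} [Ring A] [Algebra ℂ A] (v : I → I → A) (d : ℕ)
    (T : I → I → WordSpace I →ₗ[ℂ] WordSpace I) : Prop :=
  ∀ w, P.Normal w → w.length < d → ∀ p q, T p q (word w) ∈ P.normalLT (w.length + 2) ∧
    evalWords v (T p q (word w)) = evalWords v (word w) * v p q

section good

variable {A : Type*} [Ring A] [Algebra ℂ A] {v : I → I → A} {d : ℕ}
  {T T' : I → I → WordSpace I →ₗ[ℂ] WordSpace I}

-- Linearity passes from words to combinations. The corner step needs this, since it applies one
-- rewriting to the output of another.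
omit [Fintype I] [DecidableEq I] in
theorem mul_spec_ext {S : WordSpace I →ₗ[ℂ] WordSpace I} {y : A}
    (h : ∀ w, P.Normal w → w.length < d → S (word w) ∈ P.normalLT (w.length + 2) ∧
      evalWords v (S (word w)) = evalWords v (word w) * y)
    {a : WordSpace I} (ha : a ∈ P.normalLT d) :
    S a ∈ P.normalLT (d + 1) ∧ evalWords v (S a) = evalWords v a * y := by
  constructor
  · exact map_mem_of_words S _
      (fun w hw => normalLT_mono (by have := hw.2; omega) (h w hw.1 hw.2).1) ha
  · exact map_eq_of_normalLT (f := evalWords v ∘ₗ S)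
      (g := LinearMap.mulRight ℂ y ∘ₗ evalWords v) (fun w hw hl => (h w hw hl).2) ha

-- A relation, multiplied by `a` on the left and solved for its term `i₀`. Each rewriting step
-- replaces a product in this way.
omit [Algebra ℂ A] in
theorem ite_sub_sum_erase {a t : A} {f g : I → A} {c : Prop} [Decidable c] (i₀ : I)
    (h : ∑ i, f i * g i = if c then 1 else 0) (ht : t = a * f i₀) :
    (if c then a else 0) - ∑ i ∈ Finset.univ.erase i₀, a * f i * g i = t * g i₀ := by
  have h2 : ∑ i, a * f i * g i = if c then a else 0 := by
    simp_rw [mul_assoc, ← Finset.mul_sum, h]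
    simp
  rw [← h2, ← Finset.add_sum_erase _ _ (Finset.mem_univ i₀), ht]
  abel

omit [Fintype I] [DecidableEq I] in
theorem ite_word_mem {c : Prop} [Decidable c] {w : List (I × I)} (hw : P.Normal w) {e : ℕ}
    (he : w.length < e) : (if c then word w else 0) ∈ P.normalLT e := by
  split_ifs
  · exact word_mem_normalLT hw he
  · exact zero_mem _

/-- A factor `(top, m) (bot, q)` is replaced by the column relation. The remaining terms end in
`(inv i, q)` with both indices different from `bot`, so these letters are appended without further
rewriting. -/
theorem stepTop_spec (hv : P.Rel v) (hT : P.IsMul v d T) {q : I} (hq : q ≠ P.bot)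
    {w : List (I × I)} (hw : P.Normal w) (hd : w.length < d + 1) :
    P.stepTop T q (word w) ∈ P.normalLT (w.length + 2) ∧
      evalWords v (P.stepTop T q (word w)) = evalWords v (word w) * v P.bot q := by
  rcases w with _ | ⟨⟨x, m⟩, w⟩
  · simp only [stepTop, ofWords_word]
    exact ⟨word_mem_normalLT (by simp) (by simp), by simp⟩
  have hw' : w.length < d := by simpa using hd
  simp only [stepTop, ofWords_word]
  by_cases h1 : x = P.top
  · subst h1
    simp only [if_true]
    refine ⟨sub_mem (ite_word_mem hw.2 (by simp; omega)) (sum_mem fun i hi => ?_), ?_⟩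
    · exact app_mem_normalLT (P.inv_ne_bot (Finset.ne_of_mem_erase hi)) hq
        (hT w hw.2 hw' i m).1
    · simp only [map_sub, map_sum, evalWords_app, (hT w hw.2 hw' _ _).2, evalWords_cons,
        apply_ite (evalWords v), map_zero]
      exact ite_sub_sum_erase (f := fun i => v i m) (g := fun i => v (P.inv i) q) P.top
        (hv.col m q) rfl |>.trans (by rw [inv_top])
  · simp only [h1, if_false]
    exact ⟨word_mem_normalLT ⟨by simp [h1, hq], hw⟩ (by simp), by simp⟩

theorem stepLeft_spec (hv : P.Rel v) (hT : P.IsMul v d T) {p : I} (hp : p ≠ P.bot)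
    {w : List (I × I)} (hw : P.Normal w) (hd : w.length < d + 1) :
    P.stepLeft T p (word w) ∈ P.normalLT (w.length + 2) ∧
      evalWords v (P.stepLeft T p (word w)) = evalWords v (word w) * v p P.bot := by
  rcases w with _ | ⟨⟨m, x⟩, w⟩
  · simp only [stepLeft, ofWords_word]
    exact ⟨word_mem_normalLT (by simp) (by simp), by simp⟩
  have hw' : w.length < d := by simpa using hd
  simp only [stepLeft, ofWords_word]
  by_cases h1 : x = P.top
  · subst h1
    simp only [if_true]
    refine ⟨sub_mem (ite_word_mem hw.2 (by simp; omega)) (sum_mem fun i hi => ?_), ?_⟩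
    · exact app_mem_normalLT hp (P.inv_ne_bot (Finset.ne_of_mem_erase hi))
        (hT w hw.2 hw' m i).1
    · simp only [map_sub, map_sum, evalWords_app, (hT w hw.2 hw' _ _).2, evalWords_cons,
        apply_ite (evalWords v), map_zero]
      exact ite_sub_sum_erase (f := fun i => v m i) (g := fun i => v p (P.inv i)) P.top
        (hv.row m p) rfl |>.trans (by rw [inv_top])
  · simp only [h1, if_false]
    exact ⟨word_mem_normalLT ⟨by simp [h1, hp], hw⟩ (by simp), by simp⟩

/-- The remaining terms of the relation end in letters with one index `bot`, so a second rewriting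
follows. It acts on words at most as long as the given one, and there `stepTop` and `stepLeft` rely
only on `T` below length `d`. -/
theorem stepCorner_spec (hv : P.Rel v) (hT : P.IsMul v d T)
    {w : List (I × I)} (hw : P.Normal w) (hd : w.length < d + 1) :
    P.stepCorner T (word w) ∈ P.normalLT (w.length + 2) ∧
      evalWords v (P.stepCorner T (word w)) = evalWords v (word w) * v P.bot P.bot := by
  rcases w with _ | ⟨⟨y, x⟩, w⟩
  · simp only [stepCorner, ofWords_word]
    exact ⟨word_mem_normalLT (by simp) (by simp), by simp⟩
  have hw' : w.length < d := by simpa using hd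
  simp only [stepCorner, ofWords_word]
  by_cases h1 : x = P.top
  · subst h1
    simp only [if_true]
    have key : ∀ j ∈ Finset.univ.erase P.top, _ := fun j hj =>
      mul_spec_ext (v := v) (S := P.stepTop T (P.inv j)) (y := v P.bot (P.inv j))
        (d := w.length + 2) (fun w'' h h' => stepTop_spec hv hT
          (P.inv_ne_bot (Finset.ne_of_mem_erase hj)) h (by omega)) (hT w hw.2 hw' y j).1
    refine ⟨sub_mem (ite_word_mem hw.2 (by simp; omega)) (sum_mem fun j hj => (key j hj).1), ?_⟩
    rw [map_sub, map_sum, Finset.sum_congr rfl fun j hj => (key j hj).2]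
    simp only [(hT w hw.2 hw' _ _).2, evalWords_cons, apply_ite (evalWords v), map_zero]
    exact ite_sub_sum_erase (f := fun i => v y i) (g := fun i => v P.bot (P.inv i)) P.top
        (hv.row y P.bot) rfl |>.trans (by rw [inv_top])
  by_cases h2 : y = P.top
  · subst h2
    simp only [h1, if_false, if_true]
    have key : ∀ j ∈ Finset.univ.erase P.top, _ := fun j hj =>
      mul_spec_ext (v := v) (S := P.stepLeft T (P.inv j)) (y := v (P.inv j) P.bot)
        (d := w.length + 2) (fun w'' h h' => stepLeft_spec hv hT
          (P.inv_ne_bot (Finset.ne_of_mem_erase hj)) h (by omega)) (hT w hw.2 hw' j x).1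
    refine ⟨sub_mem (zero_mem _) (sum_mem fun j hj => (key j hj).1), ?_⟩
    rw [map_sub, map_sum, Finset.sum_congr rfl fun j hj => (key j hj).2]
    simp only [(hT w hw.2 hw' _ _).2, evalWords_cons, map_zero]
    refine Eq.trans ?_ (ite_sub_sum_erase (f := fun i => v i x) (g := fun i => v (P.inv i) P.bot)
      P.top (hv.col x P.bot) rfl |>.trans (by rw [inv_top]))
    rw [inv_bot, if_neg h1]
  · simp only [h1, h2, if_false]
    exact ⟨word_mem_normalLT ⟨by simp [h1, h2], hw⟩ (by simp), by simp⟩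

theorem IsMul.step (hv : P.Rel v) (hT : P.IsMul v d T) : P.IsMul v (d + 1) (P.step T) := by
  intro w hw hd p q
  unfold IndexPairing.step
  by_cases hp : p = P.bot <;> by_cases hq : q = P.bot
  · rw [if_pos hp, if_pos hq, hp, hq]; exact stepCorner_spec hv hT hw hd
  · rw [if_pos hp, if_neg hq, hp]; exact stepTop_spec hv hT hq hw hd
  · rw [if_neg hp, if_pos hq, hq]; exact stepLeft_spec hv hT hp hw hd
  · rw [if_neg hp, if_neg hq]
    exact ⟨app_mem_normalLT hp hq (word_mem_normalLT hw (by omega)), by simp⟩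

/-- Two families of operators agree on the short normal words. -/
def Agree (P : IndexPairing I) (d : ℕ) (T T' : I → I → WordSpace I →ₗ[ℂ] WordSpace I) : Prop :=
  ∀ w, P.Normal w → w.length < d → ∀ p q, T p q (word w) = T' p q (word w)

omit [Fintype I] [DecidableEq I] in
theorem Agree.tail (h : P.Agree d T T') {x : I × I} {w : List (I × I)} (hw : P.Normal (x :: w))
    (hd : (x :: w).length < d + 1) (p q : I) : T p q (word w) = T' p q (word w) :=
  h w hw.2 (by simpa using hd) p q

theorem Agree.stepTop (h : P.Agree d T T') (q : I) {w : List (I × I)} (hw : P.Normal w)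
    (hd : w.length < d + 1) : P.stepTop T q (word w) = P.stepTop T' q (word w) := by
  rcases w with _ | ⟨x, w⟩
  · simp [IndexPairing.stepTop]
  · simp only [IndexPairing.stepTop, ofWords_word, h.tail hw hd]

theorem Agree.stepLeft (h : P.Agree d T T') (p : I) {w : List (I × I)} (hw : P.Normal w)
    (hd : w.length < d + 1) : P.stepLeft T p (word w) = P.stepLeft T' p (word w) := by
  rcases w with _ | ⟨x, w⟩
  · simp [IndexPairing.stepLeft]
  · simp only [IndexPairing.stepLeft, ofWords_word, h.tail hw hd]

/-- The operator `T` is applied twice in the corner step; `hT` bounds the length of its first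
output, so that the agreement also covers the second application. -/
theorem Agree.step (h : P.Agree d T T') (hT : P.IsMul v d T) :
    P.Agree (d + 1) (P.step T) (P.step T') := by
  intro w hw hd p q
  unfold IndexPairing.step
  split_ifs
  · rcases w with _ | ⟨x, w⟩
    · simp [stepCorner]
    · have hw' : w.length < d := by simpa using hd
      have top : ∀ j j', P.stepTop T j' (T x.1 j (word w)) =
          P.stepTop T' j' (T' x.1 j (word w)) := fun j j' => by
        rw [← h.tail hw hd]
        exact map_eq_of_normalLT (fun w'' h1 h2 => h.stepTop j' h1 (by omega))
          (hT w hw.2 hw' _ _).1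
      have left : ∀ j j', P.stepLeft T j' (T j x.2 (word w)) =
          P.stepLeft T' j' (T' j x.2 (word w)) := fun j j' => by
        rw [← h.tail hw hd]
        exact map_eq_of_normalLT (fun w'' h1 h2 => h.stepLeft j' h1 (by omega))
          (hT w hw.2 hw' _ _).1
      simp only [stepCorner, ofWords_word, top, left]
  · exact h.stepTop q hw hd
  · exact h.stepLeft p hw hd
  · rfl

end good

/-! ### Right multiplication by a letter as the stable value of the recursion. -/

section limit

/-- Approximations of the right multiplications by letters. -/
noncomputable def approx (P : IndexPairing I) (d : ℕ) : I → I → WordSpace I →ₗ[ℂ] WordSpace I :=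
  P.step^[d] 0

/-- Right multiplication by a letter on the span of the normal words. -/
noncomputable def letterMul (P : IndexPairing I) (p q : I) : WordSpace I →ₗ[ℂ] WordSpace I :=
  ofWords fun w => P.approx (w.length + 1) p q (word w)

variable {A : Type*} [Ring A] [Algebra ℂ A] {v : I → I → A}

theorem approx_succ (d : ℕ) : P.approx (d + 1) = P.step (P.approx d) :=
  Function.iterate_succ_apply' _ _ _

theorem isMul_approx (hv : P.Rel v) (d : ℕ) : P.IsMul v d (P.approx d) := by
  induction d with
  | zero => intro w _ h; exact absurd h (Nat.not_lt_zero _)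
  | succ d ih => rw [approx_succ]; exact ih.step hv

/-- The zero ring satisfies the relations. Used there, `IsMul` retains only its statement on
normality and length, free of any choice of algebra. -/
theorem rel_zero : P.Rel (A := PUnit.{1}) (fun _ _ => 0) :=
  ⟨fun _ _ => Subsingleton.elim _ _, fun _ _ => Subsingleton.elim _ _⟩

theorem agree_approx (d k : ℕ) : P.Agree d (P.approx d) (P.approx (d + k)) := by
  induction d with
  | zero => intro w _ h; exact absurd h (Nat.not_lt_zero _)
  | succ d ih =>
    rw [Nat.succ_add, approx_succ, approx_succ]
    exact ih.step (isMul_approx rel_zero d)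

theorem agree_letterMul (d : ℕ) : P.Agree d (P.approx d) P.letterMul := by
  intro w hw hd p q
  obtain ⟨k, rfl⟩ := Nat.exists_eq_add_of_le (Nat.succ_le_of_lt hd)
  rw [letterMul, ofWords_word]
  exact (agree_approx (w.length + 1) k w hw (Nat.lt_succ_self _) p q).symm

theorem isMul_letterMul (hv : P.Rel v) (d : ℕ) : P.IsMul v d P.letterMul := by
  intro w hw hd p q
  rw [← agree_letterMul d w hw hd]
  exact isMul_approx hv d w hw hd p q

/-- The stable value is a fixed point of the recursion, which makes the rewriting rules available
for `letterMul` itself. -/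
theorem letterMul_eq_step {w : List (I × I)} (hw : P.Normal w) (p q : I) :
    P.letterMul p q (word w) = P.step P.letterMul p q (word w) := by
  have h := (agree_letterMul (P := P) w.length).step (isMul_approx rel_zero _) w hw
    (Nat.lt_succ_self _) p q
  rw [← h, ← approx_succ]
  exact (agree_letterMul (w.length + 1) w hw (Nat.lt_succ_self _) p q).symm

end limit
end IndexPairing

/-! ### The relations hold on the span of the normal words. -/

namespace IndexPairing

variable {I : Type*} [Fintype I] [DecidableEq I] {P : IndexPairing I}

section relations

/-- The relation number `(i, k)` between the rows, for right multiplications `R` on `a`. -/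
def RowAt (P : IndexPairing I) {W : Type*} [AddCommGroup W] [Module ℂ W]
    (R : I → I → W →ₗ[ℂ] W) (i k : I) (a : W) : Prop :=
  ∑ j, R k (P.inv j) (R i j a) = if i = P.inv k then a else 0

variable {W : Type*} [AddCommGroup W] [Module ℂ W] (R : I → I → W →ₗ[ℂ] W)

/-- The relations with first index `bot` follow from the others on a vector that arises by right
multiplication with a letter `(top, m)`. -/
theorem rowAt_bot {a b : W} {m k : I}
    (hcol : ∀ j, P.RowAt (fun p q => R q p) m j a) (hb : R P.top m a = b)
    (hrow : ∀ i, i ≠ P.bot → P.RowAt R i k (R (P.inv i) m a)) : P.RowAt R P.bot k b := by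
  -- The column relation expresses `v top m * v bot j` by products `v i m * v (inv i) j` with `inv i
  -- ≠ bot`, to which the known row relations apply.
  have h1 : ∀ j, R P.bot j b = (if m = P.inv j then a else 0)
      - ∑ i ∈ Finset.univ.erase P.top, R (P.inv i) j (R i m a) := fun j => by
    have h := hcol j
    unfold RowAt at h
    rw [← h, ← Finset.add_sum_erase _ _ (Finset.mem_univ P.top), hb, inv_top]
    abel
  have h2 : ∀ i ∈ Finset.univ.erase P.top,
      ∑ j, R k (P.inv j) (R (P.inv i) j (R i m a)) = if i = k then R k m a else 0 := fun i hi => by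
    have h := hrow (P.inv i) (P.inv_ne_bot (Finset.ne_of_mem_erase hi))
    unfold RowAt at h
    simp only [P.inv_inj, P.inv_inv] at h
    rw [h]
    split_ifs with e
    · rw [e]
    · rfl
  unfold RowAt
  simp only [h1, map_sub, map_sum, Finset.sum_sub_distrib]
  rw [Finset.sum_comm, Finset.sum_congr rfl h2]
  have h3 : ∑ j, R k (P.inv j) (if m = P.inv j then a else 0) = R k m a := by
    rw [P.sum_inv (fun j => R k j (if m = j then a else 0))]
    simp [apply_ite]
  rw [h3, Finset.sum_ite_eq']
  -- The term `i = top` is missing from the sum. For `k = top` this leaves exactly `R top m a = b`;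
  -- otherwise the two contributions cancel.
  by_cases hk : k = P.top
  · subst hk
    simp [hb, inv_top]
  · rw [if_pos (by simp [hk]), if_neg (fun e => hk (by rw [← P.inv_inv k, ← e, inv_bot])), sub_self]

/-- The two relations with the same leading word agree, given the other ones. -/
theorem rowAt_top_bot {a : W} (hrow : ∀ i, P.RowAt R i (P.inv i) a)
    (hcol : ∀ j, j ≠ P.top → P.RowAt (fun p q => R q p) j (P.inv j) a) :
    P.RowAt (fun p q => R q p) P.top P.bot a := by
  unfold RowAt at *
  simp only [P.inv_inv, if_true] at hrow hcol
  -- The double sum of `v i j * v (inv i) (inv j)` is evaluated by rows. Grouped by columns, all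
  -- groups but one are known, which determines the last.
  have h1 : ∑ j, ∑ i, R (P.inv i) (P.inv j) (R i j a) = ∑ _j : I, a := by
    rw [Finset.sum_comm]
    exact Finset.sum_congr rfl fun i _ => hrow i
  rw [← Finset.add_sum_erase _ _ (Finset.mem_univ P.top),
    ← Finset.add_sum_erase _ (fun _ => a) (Finset.mem_univ P.top),
    Finset.sum_congr rfl fun j hj => hcol j (Finset.ne_of_mem_erase hj)] at h1
  have h2 := add_right_cancel h1
  rw [inv_top] at h2
  rw [h2, inv_bot, if_pos rfl]

end relations

theorem letterMul_mem {d : ℕ} {a : WordSpace I} (ha : a ∈ P.normalLT d) (p q : I) :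
    P.letterMul p q a ∈ P.normalLT (d + 1) :=
  (mul_spec_ext (v := fun _ _ => (0 : PUnit.{1})) (y := 0) (fun _ hw hd =>
    ⟨(isMul_letterMul rel_zero d _ hw hd p q).1, Subsingleton.elim _ _⟩) ha).1

theorem letterMul_mem_normalSpan {a : WordSpace I} (ha : a ∈ P.normalSpan) (p q : I) :
    P.letterMul p q a ∈ P.normalSpan :=
  map_mem_of_words _ _ (fun _ hw => normalLT_le_normalSpan _
    (letterMul_mem (word_mem_normalLT hw (Nat.lt_succ_self _)) p q)) ha

theorem evalWords_letterMul {A : Type*} [Ring A] [Algebra ℂ A] {v : I → I → A} (hv : P.Rel v)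
    {a : WordSpace I} (ha : a ∈ P.normalSpan) (p q : I) :
    evalWords v (P.letterMul p q a) = evalWords v a * v p q :=
  map_eq_of_normalSpan (f := evalWords v ∘ₗ P.letterMul p q)
    (g := LinearMap.mulRight ℂ (v p q) ∘ₗ evalWords v)
    (fun w hw => (isMul_letterMul hv (w.length + 1) w hw (Nat.lt_succ_self _) p q).2) ha

theorem letterMul_eq_step_of_mem {a : WordSpace I} (ha : a ∈ P.normalSpan) (p q : I) :
    P.letterMul p q a = P.step P.letterMul p q a :=
  map_eq_of_normalSpan (fun _ hw => letterMul_eq_step hw p q) ha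

theorem letterMul_eq_app {a : WordSpace I} (ha : a ∈ P.normalSpan) {p q : I} (hp : p ≠ P.bot)
    (hq : q ≠ P.bot) : P.letterMul p q a = app (p, q) a := by
  rw [letterMul_eq_step_of_mem ha, step, if_neg hp, if_neg hq]

theorem letterMul_eq_stepTop {a : WordSpace I} (ha : a ∈ P.normalSpan) {q : I}
    (hq : q ≠ P.bot) : P.letterMul P.bot q a = P.stepTop P.letterMul q a := by
  rw [letterMul_eq_step_of_mem ha, step, if_pos rfl, if_neg hq]

theorem letterMul_eq_stepLeft {a : WordSpace I} (ha : a ∈ P.normalSpan) {p : I}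
    (hp : p ≠ P.bot) : P.letterMul p P.bot a = P.stepLeft P.letterMul p a := by
  rw [letterMul_eq_step_of_mem ha, step, if_neg hp, if_pos rfl]

theorem letterMul_eq_stepCorner {a : WordSpace I} (ha : a ∈ P.normalSpan) :
    P.letterMul P.bot P.bot a = P.stepCorner P.letterMul a := by
  rw [letterMul_eq_step_of_mem ha, step, if_pos rfl, if_pos rfl]

theorem letterMul_word {w : List (I × I)} {p q : I} (h : P.Normal ((p, q) :: w)) :
    P.letterMul p q (word w) = word ((p, q) :: w) := by
  rw [letterMul_eq_step h.2, step]
  have h1 := h.1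
  rcases w with _ | ⟨⟨x, y⟩, w⟩
  · split_ifs <;> simp_all [stepTop, stepCorner, stepLeft]
  · split_ifs with hp hq hq
    · subst hp hq
      simp only [allowed_cons, and_true] at h1
      simp [stepCorner, h1]
    · subst hp
      simp only [allowed_cons, and_true] at h1
      simp [stepTop, h1]
    · subst hq
      simp only [allowed_cons, and_true] at h1
      simp [stepLeft, h1]
    · simp

/-- If `(i, top)` can be appended without rewriting, the term `j = top` of the relation is the
product that `stepLeft` or `stepCorner` defines by this very relation. -/
theorem rowAt_of_normal {w : List (I × I)} {i : I} (h : P.Normal ((i, P.top) :: w)) (k : I) :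
    P.RowAt P.letterMul i k (word w) := by
  have hw := word_mem_normalSpan h.2
  unfold RowAt
  rw [← Finset.add_sum_erase _ _ (Finset.mem_univ P.top), letterMul_word h, inv_top]
  have h' := word_mem_normalSpan h
  by_cases hk : k = P.bot
  · subst hk
    rw [letterMul_eq_stepCorner h', stepCorner, ofWords_word]
    simp only [if_true, inv_bot]
    rw [sub_add_eq_add_sub, sub_eq_iff_eq_add]
    refine congrArg _ ?_
    exact Finset.sum_congr rfl fun j hj => letterMul_eq_stepTop (letterMul_mem_normalSpan hw _ _)
      (P.inv_ne_bot (Finset.ne_of_mem_erase hj))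
  · rw [letterMul_eq_stepLeft h' hk, stepLeft, ofWords_word]
    simp only [if_true]
    rw [sub_add_eq_add_sub, sub_eq_iff_eq_add]
    refine congrArg _ ?_
    exact Finset.sum_congr rfl fun j hj => letterMul_eq_app (letterMul_mem_normalSpan hw _ _) hk
      (P.inv_ne_bot (Finset.ne_of_mem_erase hj))

/-- As for rows, the relation is the definition of its leading term. The pair `(top, bot)` is
excluded because `stepCorner` rewrites `(top, top) (bot, bot)` by the row relation. -/
theorem colAt_of_normal {w : List (I × I)} {i : I} (h : P.Normal ((P.top, i) :: w)) {k : I}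
    (hik : i ≠ P.top ∨ k ≠ P.bot) :
    P.RowAt (fun p q => P.letterMul q p) i k (word w) := by
  have hw := word_mem_normalSpan h.2
  unfold RowAt
  rw [← Finset.add_sum_erase _ _ (Finset.mem_univ P.top), letterMul_word h, inv_top]
  have h' := word_mem_normalSpan h
  by_cases hk : k = P.bot
  · subst hk
    replace hik : i ≠ P.top := by simpa using hik
    rw [letterMul_eq_stepCorner h', stepCorner, ofWords_word]
    simp only [hik, if_false, if_true, inv_bot]
    rw [sub_add_eq_add_sub, sub_eq_iff_eq_add]
    refine congrArg _ ?_
    exact Finset.sum_congr rfl fun j hj => letterMul_eq_stepLeft (letterMul_mem_normalSpan hw _ _)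
      (P.inv_ne_bot (Finset.ne_of_mem_erase hj))
  · rw [letterMul_eq_stepTop h' hk, stepTop, ofWords_word]
    simp only [if_true]
    rw [sub_add_eq_add_sub, sub_eq_iff_eq_add]
    refine congrArg _ ?_
    exact Finset.sum_congr rfl fun j hj => letterMul_eq_app (letterMul_mem_normalSpan hw _ _)
      (P.inv_ne_bot (Finset.ne_of_mem_erase hj)) hk

theorem rowAt_of_words {s : Set (List (I × I))} {R : I → I → WordSpace I →ₗ[ℂ] WordSpace I}
    {i k : I} (h : ∀ w ∈ s, P.RowAt R i k (word w)) {a : WordSpace I}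
    (ha : a ∈ Finsupp.supported ℂ ℂ s) : P.RowAt R i k a := by
  have := map_eq_of_words (f := ∑ j, R k (P.inv j) ∘ₗ R i j)
    (g := if i = P.inv k then LinearMap.id else 0) (s := s) (fun w hw => by
      have := h w hw
      unfold RowAt at this
      simp only [LinearMap.sum_apply, LinearMap.comp_apply, this]
      split_ifs <;> rfl) ha
  unfold RowAt
  simp only [LinearMap.sum_apply, LinearMap.comp_apply] at this
  rw [this]
  split_ifs <;> rfl

theorem rowAt_of_ne {a : WordSpace I} (ha : a ∈ P.normalSpan) {i : I} (hi : i ≠ P.bot) (k : I) :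
    P.RowAt P.letterMul i k a :=
  rowAt_of_words (fun w hw => rowAt_of_normal (w := w)
    ⟨P.allowed_of_ne (x := (i, P.top)) hi P.top_ne_bot w, hw⟩ k) ha

theorem colAt_of_ne {a : WordSpace I} (ha : a ∈ P.normalSpan) {i k : I} (hi : i ≠ P.bot)
    (hik : i ≠ P.top ∨ k ≠ P.bot) : P.RowAt (fun p q => P.letterMul q p) i k a :=
  rowAt_of_words (fun w hw => colAt_of_normal (w := w)
    ⟨P.allowed_of_ne (x := (P.top, i)) P.top_ne_bot hi w, hw⟩ hik) ha

/-- The relations hold on the normal words. -/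
theorem rowAt_colAt (d : ℕ) : ∀ w, P.Normal w → w.length < d → ∀ i k,
    P.RowAt P.letterMul i k (word w) ∧ P.RowAt (fun p q => P.letterMul q p) i k (word w) := by
  induction d with
  | zero => intro w _ h; exact absurd h (Nat.not_lt_zero _)
  | succ d ih =>
  have row : ∀ w, P.Normal w → w.length < d + 1 → ∀ i k, P.RowAt P.letterMul i k (word w) := by
    intro w hw hd i k
    by_cases hi : i = P.bot
    · subst hi
      rcases w with _ | ⟨⟨x, m⟩, w⟩
      · exact rowAt_of_normal (by simp) k
      by_cases hx : x = P.top
      · subst hx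
        exact rowAt_bot P.letterMul (fun j => (ih w hw.2 (by simpa using hd) _ _).2)
          (letterMul_word hw) (fun i hi => rowAt_of_ne
            (letterMul_mem_normalSpan (word_mem_normalSpan hw.2) _ _) hi k)
      · exact rowAt_of_normal ⟨by simp [hx, P.top_ne_bot], hw⟩ k
    · exact rowAt_of_ne (word_mem_normalSpan hw) hi k
  have col : ∀ w, P.Normal w → w.length < d + 1 → ∀ i k, (i ≠ P.top ∨ k ≠ P.bot) →
      (i ≠ P.bot ∨ k ≠ P.bot) → P.RowAt (fun p q => P.letterMul q p) i k (word w) := by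
    intro w hw hd i k h1 h2
    by_cases hi : i = P.bot
    · subst hi
      replace h2 : k ≠ P.bot := by simpa using h2
      rcases w with _ | ⟨⟨m, x⟩, w⟩
      · exact colAt_of_normal (by simp) h1
      by_cases hx : x = P.top
      · subst hx
        exact rowAt_bot (fun p q => P.letterMul q p)
          (fun j => (ih w hw.2 (by simpa using hd) _ _).1)
          (letterMul_word hw) (fun i hi => colAt_of_ne
            (letterMul_mem_normalSpan (word_mem_normalSpan hw.2) _ _) hi (Or.inr h2))
      · exact colAt_of_normal ⟨by simp [hx, P.top_ne_bot], hw⟩ h1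
    · exact colAt_of_ne (word_mem_normalSpan hw) hi h1
  -- This is the one ambiguity of the rewriting, resolved by counting the double sum in two ways.
  have corner : ∀ w, P.Normal w → w.length < d + 1 →
      P.RowAt (fun p q => P.letterMul q p) P.top P.bot (word w) := by
    intro w hw hd
    refine rowAt_top_bot P.letterMul (fun i => row w hw hd _ _) fun j hj => ?_
    exact col w hw hd _ _ (Or.inl hj) (Or.inr (P.inv_ne_bot hj))
  have col' : ∀ w, P.Normal w → w.length < d + 1 → ∀ i, i ≠ P.bot →
      P.RowAt (fun p q => P.letterMul q p) i P.bot (word w) := by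
    intro w hw hd i hi
    by_cases h : i = P.top
    · rw [h]; exact corner w hw hd
    · exact col w hw hd _ _ (Or.inl h) (Or.inl hi)
  intro w hw hd i k
  refine ⟨row w hw hd i k, ?_⟩
  by_cases hk : k = P.bot
  · subst hk
    by_cases hi : i = P.bot
    · subst hi
      rcases w with _ | ⟨⟨m, x⟩, w⟩
      · exact colAt_of_normal (by simp) (Or.inl P.top_ne_bot.symm)
      by_cases hx : x = P.top
      · subst hx
        have hd' : w.length < d := by simpa using hd
        exact rowAt_bot (fun p q => P.letterMul q p) (fun j => (ih w hw.2 hd' _ _).1)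
          -- A letter lengthens `w` by at most one, so `col'` still applies to the words of the
          -- product.
          (letterMul_word hw) (fun i hi => rowAt_of_words
            (fun w' hw' => col' w' hw'.1 (hw'.2.trans_le (by omega)) i hi)
            (letterMul_mem (word_mem_normalLT hw.2 (Nat.lt_succ_self _)) _ _))
      · exact colAt_of_normal ⟨by simp [hx, P.top_ne_bot], hw⟩ (Or.inl P.top_ne_bot.symm)
    · exact col' w hw hd i hi
  · exact col w hw hd i k (Or.inr hk) (Or.inr hk)

theorem rowAt_normalSpan {a : WordSpace I} (ha : a ∈ P.normalSpan) (i k : I) :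
    P.RowAt P.letterMul i k a :=
  rowAt_of_words (fun w hw => (rowAt_colAt (w.length + 1) w hw (Nat.lt_succ_self _) i k).1) ha

theorem colAt_normalSpan {a : WordSpace I} (ha : a ∈ P.normalSpan) (i k : I) :
    P.RowAt (fun p q => P.letterMul q p) i k a :=
  rowAt_of_words (fun w hw => (rowAt_colAt (w.length + 1) w hw (Nat.lt_succ_self _) i k).2) ha

noncomputable instance : AddCommGroup P.normalSpan := inferInstance

/-- Right multiplication by a letter, as an element of the opposite of the endomorphism ring of the
span of the normal words. -/
noncomputable def opMul (P : IndexPairing I) (p q : I) : (Module.End ℂ P.normalSpan)ᵐᵒᵖ :=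
  MulOpposite.op ((P.letterMul p q).restrict fun _ ha => letterMul_mem_normalSpan ha p q)

theorem rel_opMul : P.Rel P.opMul := by
  constructor
  · intro i k
    apply MulOpposite.unop_injective
    ext a : 1
    have := rowAt_normalSpan a.2 i k
    unfold RowAt at this
    apply Subtype.ext
    simp only [opMul, ← MulOpposite.op_mul, ← Finset.op_sum, MulOpposite.unop_op,
      LinearMap.sum_apply, Module.End.mul_apply, AddSubmonoidClass.coe_finsetSum,
      LinearMap.coe_restrict_apply, this]
    split_ifs <;> simp
  · intro i k
    apply MulOpposite.unop_injective
    ext a : 1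
    have := colAt_normalSpan a.2 i k
    unfold RowAt at this
    apply Subtype.ext
    simp only [opMul, ← MulOpposite.op_mul, ← Finset.op_sum, MulOpposite.unop_op,
      LinearMap.sum_apply, Module.End.mul_apply, AddSubmonoidClass.coe_finsetSum,
      LinearMap.coe_restrict_apply, this]
    split_ifs <;> simp

end IndexPairing

/-! ### Normal forms, last-letter coefficients and the length filtration. -/

namespace IndexPairing

variable {I : Type*} [Fintype I] [DecidableEq I] {P : IndexPairing I}

/-- The algebra `A` is presented by the generators `v` and the relations `P.Rel`, expressed by the
existence of the representation on the normal words. -/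
structure Presentation (P : IndexPairing I) {A : Type*} [Ring A] [Algebra ℂ A] (v : I → I → A) where
  rel : P.Rel v
  adjoin_eq_top : Algebra.adjoin ℂ {a | ∃ p q, v p q = a} = ⊤
  rep : A →ₐ[ℂ] (Module.End ℂ P.normalSpan)ᵐᵒᵖ
  rep_gen : ∀ p q, rep (v p q) = P.opMul p q

/-- The coefficients of the words ending in a given letter. -/
noncomputable def del (x : I × I) : WordSpace I →ₗ[ℂ] WordSpace I :=
  Finsupp.lcomapDomain (List.cons x) (List.cons_injective)

omit [Fintype I] [DecidableEq I] in
theorem del_apply (x : I × I) (c : WordSpace I) (w : List (I × I)) : del x c w = c (x :: w) := rfl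

omit [Fintype I] in
theorem del_app (x y : I × I) (c : WordSpace I) :
    del y (app x c) = if x = y then c else 0 := by
  ext w
  rw [del_apply]
  change Finsupp.mapDomain (List.cons x) c (y :: w) = _
  split_ifs with h
  · subst h
    exact Finsupp.mapDomain_apply List.cons_injective c w
  · refine Finsupp.mapDomain_of_notMem_range _ _ ?_
    rintro ⟨w', h'⟩
    simp_all

omit [Fintype I] [DecidableEq I] in
theorem del_mem {x : I × I} {d : ℕ} {c : WordSpace I} (hc : c ∈ P.normalLT d) :
    del x c ∈ P.normalLT (d - 1) := by
  rw [normalLT, Finsupp.mem_supported'] at hc ⊢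
  intro w hw
  refine hc _ fun h => hw ⟨h.1.2, ?_⟩
  have := h.2
  simp only [List.length_cons] at this
  omega

omit [Fintype I] [DecidableEq I] in
theorem del_mem_normalSpan {x : I × I} {c : WordSpace I} (hc : c ∈ P.normalSpan) :
    del x c ∈ P.normalSpan := by
  rw [normalSpan, Finsupp.mem_supported'] at hc ⊢
  exact fun w hw => hc _ fun h => hw h.2

theorem letterMul_eq_app_of_support {p q : I} {c : WordSpace I}
    (hc : ∀ w, c w ≠ 0 → P.Normal ((p, q) :: w)) : P.letterMul p q c = app (p, q) c :=
  map_eq_of_words (s := {w | P.Normal ((p, q) :: w)})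
    (fun w hw => by rw [letterMul_word hw, app_word])
    ((Finsupp.mem_supported' _ _).2 fun w hw => by_contra fun h => hw (hc w h))

omit [Fintype I] [DecidableEq I] in
theorem exists_mem_normalLT {c : WordSpace I} (hc : c ∈ P.normalSpan) : ∃ d, c ∈ P.normalLT d := by
  refine ⟨c.support.sup List.length + 1, (Finsupp.mem_supported _ _).2 fun w hw => ⟨hc hw, ?_⟩⟩
  exact Nat.lt_succ_of_le (Finset.le_sup (f := List.length) hw)

namespace Presentation

variable {A : Type*} [Ring A] [Algebra ℂ A] {v : I → I → A} (D : P.Presentation v)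

/-- The normal form of an element. -/
noncomputable def nf : A →ₗ[ℂ] WordSpace I where
  toFun a := ((D.rep a).unop ⟨word [], word_mem_normalSpan P.normal_nil⟩ : P.normalSpan)
  map_add' := by simp
  map_smul' := by simp

theorem nf_mem (a : A) : D.nf a ∈ P.normalSpan := Subtype.property _

theorem nf_one : D.nf 1 = word [] := by simp [nf]

theorem nf_mul_gen (a : A) (p q : I) : D.nf (a * v p q) = P.letterMul p q (D.nf a) := by
  simp only [nf, LinearMap.coe_mk, AddHom.coe_mk, map_mul, D.rep_gen, opMul, MulOpposite.unop_mul,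
    MulOpposite.unop_op, Module.End.mul_apply, LinearMap.coe_restrict_apply]

/-- Evaluation intertwines the representation with right multiplication in `A`. Applied to the empty
word, it recovers an element from its normal form. -/
theorem evalWords_rep (b : A) : ∀ c : P.normalSpan,
    evalWords v ((D.rep b).unop c : P.normalSpan) = evalWords v (c : WordSpace I) * b := by
  have hb : b ∈ Algebra.adjoin ℂ {a | ∃ p q, v p q = a} := D.adjoin_eq_top ▸ Algebra.mem_top
  induction hb using Algebra.adjoin_induction with
  | mem x hx =>
    obtain ⟨p, q, rfl⟩ := hx
    intro c
    simp only [D.rep_gen, opMul, MulOpposite.unop_op, LinearMap.coe_restrict_apply]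
    exact evalWords_letterMul D.rel c.2 p q
  | algebraMap r => intro c; simp [Algebra.algebraMap_eq_smul_one]
  | add x y _ _ hx hy => intro c; simp [hx, hy, mul_add]
  | mul x y _ _ hx hy => intro c; simp [hx, hy, mul_assoc]

theorem evalWords_nf (a : A) : evalWords v (D.nf a) = a := by
  exact (D.evalWords_rep a ⟨word [], word_mem_normalSpan P.normal_nil⟩).trans (by simp)

/-- A normal word is built from the empty word letter by letter, and no rewriting ever occurs. -/
theorem nf_evalWords {c : WordSpace I} (hc : c ∈ P.normalSpan) : D.nf (evalWords v c) = c := by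
  refine map_eq_of_normalSpan (f := D.nf ∘ₗ evalWords v) (g := LinearMap.id) (fun w hw => ?_) hc
  simp only [LinearMap.comp_apply, LinearMap.id_apply]
  induction w with
  | nil => rw [evalWords_nil, D.nf_one]
  | cons x w ih => rw [evalWords_cons, D.nf_mul_gen, ih hw.2, letterMul_word hw]

theorem nf_injective : Function.Injective D.nf :=
  Function.LeftInverse.injective D.evalWords_nf

/-- The coefficient of the last letter `(p, q)` in the normal form. -/
noncomputable def coeff (p q : I) : A →ₗ[ℂ] A := evalWords v ∘ₗ del (p, q) ∘ₗ D.nf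

theorem nf_coeff (p q : I) (a : A) : D.nf (D.coeff p q a) = del (p, q) (D.nf a) :=
  D.nf_evalWords (del_mem_normalSpan (D.nf_mem a))

theorem coeff_mul_aux {a : A} {p q : I} (h : ∀ w, D.nf a w ≠ 0 → P.Normal ((p, q) :: w))
    (k l : I) : D.coeff k l (a * v p q) = if p = k ∧ q = l then a else 0 := by
  apply D.nf_injective
  rw [nf_coeff, nf_mul_gen, letterMul_eq_app_of_support h, del_app]
  simp only [Prod.mk.injEq]
  split_ifs <;> simp

theorem normal_of_ne_zero {a : A} {w : List (I × I)} (h : D.nf a w ≠ 0) : P.Normal w :=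
  D.nf_mem a (Finsupp.mem_support_iff.2 h)

theorem coeff_mul_gen {p q : I} (hp : p ≠ P.bot) (hq : q ≠ P.bot) (a : A) (k l : I) :
    D.coeff k l (a * v p q) = if p = k ∧ q = l then a else 0 :=
  D.coeff_mul_aux (fun _ h => ⟨P.allowed_of_ne hp hq _, D.normal_of_ne_zero h⟩) k l

/-- For `q ≠ bot`, only words ending in some `(top, m)` forbid the letter `(bot, q)`, and `ha`
excludes them. -/
theorem coeff_mul_bot_left {q : I} (hq : q ≠ P.bot) {a : A} (ha : ∀ m, D.coeff P.top m a = 0)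
    (k l : I) : D.coeff k l (a * v P.bot q) = if P.bot = k ∧ q = l then a else 0 := by
  refine D.coeff_mul_aux (fun w h => ⟨fun y hy => ⟨fun e => h ?_, fun e => hq e.2⟩,
    D.normal_of_ne_zero h⟩) k l
  obtain ⟨w', rfl⟩ := List.head?_eq_some_iff.1 hy
  obtain ⟨y1, y2⟩ := y
  obtain rfl : y1 = P.top := e.1
  have := congrArg (D.nf · w') (ha y2)
  simpa [nf_coeff, del_apply] using this

theorem coeff_mul_bot_right {p : I} (hp : p ≠ P.bot) {a : A} (ha : ∀ m, D.coeff m P.top a = 0)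
    (k l : I) : D.coeff k l (a * v p P.bot) = if p = k ∧ P.bot = l then a else 0 := by
  refine D.coeff_mul_aux (fun w h => ⟨fun y hy => ⟨fun e => hp e.2, fun e => h ?_⟩,
    D.normal_of_ne_zero h⟩) k l
  obtain ⟨w', rfl⟩ := List.head?_eq_some_iff.1 hy
  obtain ⟨y1, y2⟩ := y
  obtain rfl : y2 = P.top := e.1
  have := congrArg (D.nf · w') (ha y1)
  simpa [nf_coeff, del_apply] using this

theorem coeff_top_left (m q : I) (a : A) : D.coeff P.top m (D.coeff P.bot q a) = 0 := by
  apply D.nf_injective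
  rw [nf_coeff, nf_coeff, map_zero]
  ext w
  simp only [del_apply, Finsupp.coe_zero, Pi.zero_apply]
  by_contra h
  exact ((allowed_cons _ _ _ _).1 (D.normal_of_ne_zero h).1).1 ⟨rfl, rfl⟩

theorem coeff_top_right (m p : I) (a : A) : D.coeff m P.top (D.coeff p P.bot a) = 0 := by
  apply D.nf_injective
  rw [nf_coeff, nf_coeff, map_zero]
  ext w
  simp only [del_apply, Finsupp.coe_zero, Pi.zero_apply]
  by_contra h
  exact ((allowed_cons _ _ _ _).1 (D.normal_of_ne_zero h).1).2 ⟨rfl, rfl⟩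

/-- The elements whose normal form involves only words of length less than `d`. -/
noncomputable def filt (d : ℕ) : Submodule ℂ A := (P.normalLT d).comap D.nf

theorem mem_filt {d : ℕ} {a : A} : a ∈ D.filt d ↔ D.nf a ∈ P.normalLT d := Iff.rfl

theorem filt_mono {d d' : ℕ} (h : d ≤ d') : D.filt d ≤ D.filt d' :=
  Submodule.comap_mono (normalLT_mono h)

theorem eq_zero_of_mem_filt {a : A} (ha : a ∈ D.filt 0) : a = 0 := by
  apply D.nf_injective
  ext w
  simpa using (Finsupp.mem_supported' _ _).1 (show D.nf a ∈ P.normalLT 0 from ha) w (by simp)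

theorem exists_mem_filt (a : A) : ∃ d, a ∈ D.filt d := exists_mem_normalLT (D.nf_mem a)

theorem coeff_mem_filt {d : ℕ} {a : A} (ha : a ∈ D.filt d) (p q : I) :
    D.coeff p q a ∈ D.filt (d - 1) := by
  rw [mem_filt, nf_coeff]
  exact del_mem ha

theorem mul_gen_mem_filt {d : ℕ} {a : A} (ha : a ∈ D.filt d) (p q : I) :
    a * v p q ∈ D.filt (d + 1) := by
  rw [mem_filt, nf_mul_gen]
  exact letterMul_mem ha p q

theorem mul_gen_mem_filt_of_pred {d : ℕ} {a : A} (ha : a ∈ D.filt (d - 1)) (p q : I) :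
    a * v p q ∈ D.filt d := by
  -- For `d = 0` the truncated `d - 1` is again `0`, and `filt 0` is trivial.
  rcases d with _ | d
  · rw [D.eq_zero_of_mem_filt ha, zero_mul]
    exact zero_mem _
  · exact D.mul_gen_mem_filt ha p q

end Presentation
end IndexPairing

/-! ### The kernel equations in hyperbolic generators. -/

namespace IndexPairing.Presentation

variable {I : Type*} [Fintype I] [DecidableEq I] {P : IndexPairing I}
  {A : Type*} [Ring A] [Algebra ℂ A] {v : I → I → A} (D : P.Presentation v)

/-- Only the summand `m = bot` could require rewriting; `hf` prevents it, so every product just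
appends its letter. -/
theorem coeff_sum_row {k : I} (hk : k ≠ P.bot) {f : I → A}
    (hf : ∀ m, D.coeff m P.top (f P.bot) = 0) (k' l : I) :
    D.coeff k' l (∑ m, f m * v k m) = if k = k' then f l else 0 := by
  have h : ∀ m, D.coeff k' l (f m * v k m) = if k = k' ∧ m = l then f m else 0 := fun m => by
    by_cases hm : m = P.bot
    · subst hm
      exact D.coeff_mul_bot_right hk hf k' l
    · exact D.coeff_mul_gen hk hm _ k' l
  simp only [map_sum, h]
  by_cases e : k = k' <;> simp [e]

theorem coeff_sum_col {j : I} (hj : j ≠ P.bot) {f : I → A}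
    (hf : ∀ m, D.coeff P.top m (f P.bot) = 0) (k l : I) :
    D.coeff k l (∑ p, f p * v p j) = if j = l then f k else 0 := by
  have h : ∀ m, D.coeff k l (f m * v m j) = if m = k ∧ j = l then f m else 0 := fun m => by
    by_cases hm : m = P.bot
    · subst hm
      exact D.coeff_mul_bot_left hj hf k l
    · exact D.coeff_mul_gen hm hj _ k l
  simp only [map_sum, h]
  by_cases e : j = l <;> simp [e]

include D in
theorem sum_mul_row (f : I → A) (k : I) :
    ∑ m, (∑ l, f l * v l (P.inv m)) * v k m = f (P.inv k) := by
  simp_rw [Finset.sum_mul, mul_assoc]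
  rw [Finset.sum_comm]
  simp_rw [← Finset.mul_sum]
  have : ∀ l, ∑ m, v l (P.inv m) * v k m = if l = P.inv k then 1 else 0 := fun l => by
    rw [← D.rel.row, ← P.sum_inv]
    simp_rw [P.inv_inv]
  simp [this]

include D in
theorem sum_mul_col (f : I → A) (j : I) :
    ∑ p, (∑ m, f m * v p m) * v (P.inv p) j = f (P.inv j) := by
  simp_rw [Finset.sum_mul, mul_assoc]
  rw [Finset.sum_comm]
  simp_rw [← Finset.mul_sum, D.rel.col]
  simp

/-- The solutions of the equations `z (inv k) j + ∑ i, z i k * v (inv i) j = 0` are the left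
multiples of `v - 1`. -/
theorem exists_eq_mul_sub (d : ℕ) : ∀ z : I → I → A, (∀ i k, z i k ∈ D.filt d) →
    (∀ k j, z (P.inv k) j + ∑ i, z i k * v (P.inv i) j = 0) →
    ∃ b : A, ∀ i k, z i k = b * v i k - if i = k then b else 0 := by
  induction d with
  | zero => exact fun z hz _ => ⟨0, fun i k => by simp [D.eq_zero_of_mem_filt (hz i k)]⟩
  | succ d ih =>
  intro z hz hker
  have ht := P.top_ne_bot
  -- Here `β k` collects the part of `z top k` ending in a letter `(top, m)`. Subtracting `∑ m, β k
  -- m * v p m` in every row `p` removes that part from row `top`.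
  let β : I → I → A := fun k m => D.coeff P.top m (z P.top k)
  let y : I → I → A := fun p k => z p k - ∑ m, β k m * v p m
  have hβ : ∀ k m, β k m ∈ D.filt d := fun k m => D.coeff_mem_filt (hz _ _) _ _
  have hβC : ∀ k m, D.coeff m P.top (β k P.bot) = 0 := fun k m => D.coeff_top_right _ _ _
  have hyR : ∀ k m, D.coeff P.top m (y P.top k) = 0 := fun k m => by
    simp only [y, map_sub]
    rw [D.coeff_sum_row ht (hβC k), if_pos rfl, sub_self]
  have hsum : ∀ k j, ∑ p, y (P.inv p) k * v p j = -z (P.inv k) j - β k (P.inv j) := fun k j => by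
    rw [← P.sum_inv]
    simp_rw [P.inv_inv]
    simp only [y, sub_mul, Finset.sum_sub_distrib]
    rw [D.sum_mul_col, eq_neg_of_add_eq_zero_right (hker k j)]
  -- Since `y top k` has no word ending in `(top, m)`, the entry `y p k` is the coefficient of `(inv
  -- p, top)` in `hsum` for `j = top`; taking a coefficient lowers the degree.
  have hy : ∀ p k, y p k ∈ D.filt d := fun p k => by
    have h := D.coeff_sum_col ht (f := fun p => y (P.inv p) k)
      (by simpa only [inv_bot] using hyR k) (P.inv p) P.top
    rw [if_pos rfl, P.inv_inv, hsum] at h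
    rw [← h]
    exact D.coeff_mem_filt (d := d + 1) (sub_mem (neg_mem (hz _ _))
      (D.filt_mono (Nat.le_succ d) (hβ _ _))) _ _
  have hstar : ∀ k j, ∑ m, β j m * v k m + ∑ p, y (P.inv p) (P.inv k) * v p j ∈ D.filt d :=
    fun k j => by
      rw [hsum, P.inv_inv]
      have : ∑ m, β j m * v k m + (-z k j - β (P.inv k) (P.inv j))
          = - y k j - β (P.inv k) (P.inv j) := by simp only [y]; abel
      rw [this]
      exact sub_mem (neg_mem (hy _ _)) (hβ _ _)
  -- Both sums in `hstar` may have one degree more than their total, so their last-letter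
  -- coefficients cancel modulo `filt (d - 1)`. Comparing them forces `β j m ≡ δ b` for `j ≠ bot`
  -- and `y (inv p) (inv k) ≡ -δ b` for `k ≠ bot`.
  have hcoeff : ∀ k j, k ≠ P.bot → j ≠ P.bot → ∀ k' l, (if k = k' then β j l else 0) +
      (if j = l then y (P.inv k') (P.inv k) else 0) ∈ D.filt (d - 1) := fun k j hk hj k' l => by
    have h := D.coeff_mem_filt (hstar k j) k' l
    rwa [map_add, D.coeff_sum_row hk (hβC j), D.coeff_sum_col hj
      (f := fun p => y (P.inv p) (P.inv k)) (by simpa only [inv_bot] using hyR _)] at h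
  obtain ⟨b, hb⟩ : ∃ b, b = β P.top P.top := ⟨_, rfl⟩
  have hβb : ∀ j, j ≠ P.bot → ∀ m, β j m - (if m = j then b else 0) ∈ D.filt (d - 1) := by
    intro j hj m
    by_cases hm : m = j
    · subst hm
      have h1 := hcoeff P.top m ht hj P.top m
      have h2 := hcoeff P.top P.top ht ht P.top P.top
      simp only [if_true] at h1 h2 ⊢
      rw [hb]
      simpa using sub_mem h1 h2
    · have h1 := hcoeff P.top j ht hj P.top m
      simpa [hm, Ne.symm hm] using h1
  have hyb : ∀ k, k ≠ P.bot → ∀ p,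
      y (P.inv p) (P.inv k) + (if p = k then b else 0) ∈ D.filt (d - 1) := by
    intro k hk p
    have h1 := hcoeff k P.top hk ht p P.top
    rw [if_pos rfl, ← hb, add_comm] at h1
    simpa only [eq_comm] using h1
  have hrow : ∀ j, j ≠ P.bot → ∀ p, ∑ m, β j m * v p m - b * v p j ∈ D.filt d := by
    intro j hj p
    have := sum_mem (t := Finset.univ) fun m (_ : m ∈ Finset.univ) =>
      D.mul_gen_mem_filt_of_pred (hβb j hj m) p m
    simpa [sub_mul, Finset.sum_sub_distrib] using this
  have hcol : ∀ k, k ≠ P.bot → ∀ j,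
      ∑ p, y (P.inv p) (P.inv k) * v p j + b * v k j ∈ D.filt d := by
    intro k hk j
    have := sum_mem (t := Finset.univ) fun p (_ : p ∈ Finset.univ) =>
      D.mul_gen_mem_filt_of_pred (hyb k hk p) p j
    simpa [add_mul, Finset.sum_add_distrib] using this
  -- For `j = bot` the words of `b` ending in `(l, top)` obstruct reading off coefficients of `b * v
  -- k bot`. The row `γ` removes them from its entry `bot` at the cost of the low-degree term `c
  -- (inv k)`.
  let c : I → A := fun l => D.coeff l P.top b
  let γ : I → A := fun m => (if m = P.bot then b else 0) - ∑ l, c l * v l (P.inv m)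
  have hγ : ∀ k, ∑ m, γ m * v k m = b * v k P.bot - c (P.inv k) := fun k => by
    simp only [γ, sub_mul, Finset.sum_sub_distrib]
    rw [D.sum_mul_row]
    simp
  have hγC : ∀ m, D.coeff m P.top (γ P.bot) = 0 := fun m => by
    simp only [γ, if_true, map_sub, inv_bot]
    rw [D.coeff_sum_col ht (f := c) (fun m => D.coeff_top_left _ _ _), if_pos rfl, sub_self]
  have hb_mem : b ∈ D.filt d := hb ▸ hβ _ _
  have hc : ∀ l, c l ∈ D.filt d := fun l =>
    D.filt_mono (Nat.sub_le d 1) (D.coeff_mem_filt hb_mem _ _)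
  have hdiff : ∀ k, ∑ m, (β P.bot m - γ m) * v k m
      = ∑ m, β P.bot m * v k m - b * v k P.bot + c (P.inv k) := fun k => by
    simp only [sub_mul, Finset.sum_sub_distrib]
    rw [hγ]
    abel
  have hτ : ∀ m, β P.bot m - γ m ∈ D.filt (d - 1) := fun m => by
    have h := D.coeff_sum_row ht (f := fun m => β P.bot m - γ m)
      (fun m => by rw [map_sub, hβC, hγC, sub_zero]) P.top m
    rw [if_pos rfl, hdiff] at h
    rw [← h]
    refine D.coeff_mem_filt (add_mem ?_ (hc _)) _ _
    have := sub_mem (hstar P.top P.bot) (hcol P.top ht P.bot)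
    convert this using 1
    abel
  have hrow_bot : ∀ p, ∑ m, β P.bot m * v p m - b * v p P.bot ∈ D.filt d := fun p => by
    have := sub_mem (sum_mem (t := Finset.univ) fun m (_ : m ∈ Finset.univ) =>
      D.mul_gen_mem_filt_of_pred (hτ m) p m) (hc (P.inv p))
    rwa [hdiff, add_sub_cancel_right] at this
  have hz' : ∀ p k, z p k - (b * v p k - if p = k then b else 0) ∈ D.filt d := fun p k => by
    have h1 : ∑ m, β k m * v p m - b * v p k ∈ D.filt d := by
      by_cases hk : k = P.bot
      · rw [hk]; exact hrow_bot p
      · exact hrow k hk p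
    have h2 : (if p = k then b else 0) ∈ D.filt d := by
      split_ifs
      · exact hb_mem
      · exact zero_mem _
    have := add_mem (add_mem (hy p k) h1) h2
    simp only [y] at this
    convert this using 1
    abel
  -- The family `b(v - 1)` solves the same equations, so the induction applies to the difference.
  obtain ⟨b', hb'⟩ := ih _ hz' fun k j => by
    have h1 : ∑ i, (z i k - (b * v i k - if i = k then b else 0)) * v (P.inv i) j
        = ∑ i, z i k * v (P.inv i) j - (if k = P.inv j then b else 0) + b * v (P.inv k) j := by
      simp only [sub_mul, Finset.sum_sub_distrib, mul_assoc]
      rw [← Finset.mul_sum, D.rel.col]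
      simp [sub_add]
    rw [h1, eq_neg_of_add_eq_zero_right (hker k j)]
    simp only [P.inv_eq_iff]
    abel
  refine ⟨b' + b, fun i k => ?_⟩
  rw [eq_add_of_sub_eq (hb' i k), add_mul]
  split_ifs <;> abel

include D in
/-- No nonzero element is fixed by the right multiplication by a diagonal generator. -/
theorem eq_zero_of_mul_gen_eq {p : I} (hp : p ≠ P.bot) {a : A} (ha : a * v p p = a) : a = 0 := by
  obtain ⟨d, hd⟩ := D.exists_mem_filt a
  induction d with
  | zero => exact D.eq_zero_of_mem_filt hd
  | succ d ih =>
    refine ih ?_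
    -- The coefficient of `(p, p)` in `a * v p p` is `a` itself, while as a coefficient of `a` it
    -- lies one step lower in the filtration.
    have h := D.coeff_mul_gen hp hp a p p
    rw [ha] at h
    simp only [and_self, if_true] at h
    rw [← h]
    exact D.coeff_mem_filt hd p p

end IndexPairing.Presentation

/-! ### The change of generators between the symmetric and the hyperbolic form. -/

namespace IndexPairing

variable {I : Type*}

/-- A complex matrix, as a matrix over an algebra. -/
def scalarMat (B : Type*) [Ring B] [Algebra ℂ B] (C : Matrix I I ℂ) : Matrix I I B :=
  C.map (algebraMap ℂ B)

section scalarMat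

variable {B : Type*} [Ring B] [Algebra ℂ B]

theorem scalarMat_mul [Fintype I] (C D : Matrix I I ℂ) :
    scalarMat B C * scalarMat B D = scalarMat B (C * D) := (Matrix.map_mul).symm

theorem scalarMat_one [DecidableEq I] : scalarMat B (1 : Matrix I I ℂ) = 1 := by
  simp [scalarMat]

/-- Over a noncommutative ring transposition need not reverse products; it does here because one
factor has central entries. -/
theorem transpose_scalarMat_mul [Fintype I] (C : Matrix I I ℂ) (M : Matrix I I B) :
    (scalarMat B C * M).transpose = M.transpose * scalarMat B C.transpose := by
  ext i j
  simp [Matrix.mul_apply, scalarMat, Algebra.commutes]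

theorem transpose_mul_scalarMat [Fintype I] (C : Matrix I I ℂ) (M : Matrix I I B) :
    (M * scalarMat B C).transpose = scalarMat B C.transpose * M.transpose := by
  ext i j
  simp [Matrix.mul_apply, scalarMat, Algebra.commutes]

theorem scalarMat_mul_smul [Fintype I] (C : Matrix I I ℂ) (b : B) (M : Matrix I I B) :
    scalarMat B C * (b • M) = b • (scalarMat B C * M) := by
  ext i j
  simp only [Matrix.mul_apply, scalarMat, Matrix.map_apply, Matrix.smul_apply, smul_eq_mul,
    Finset.mul_sum, ← mul_assoc, Algebra.commutes _ b]

theorem map_scalarMat {B' : Type*} [Ring B'] [Algebra ℂ B'] (f : B →ₐ[ℂ] B') (C : Matrix I I ℂ) :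
    (scalarMat B C).map f = scalarMat B' C := by
  ext i j
  simp [scalarMat]

end scalarMat

variable [Fintype I] [DecidableEq I] (P : IndexPairing I)

/-- The permutation matrix of the involution. -/
def pairMat : Matrix I I ℂ := Matrix.of fun i j => if i = P.inv j then 1 else 0

/-- A symmetric square root of the permutation matrix of the involution. -/
noncomputable def sqrtMat : Matrix I I ℂ :=
  -- The coefficients give the eigenvalues `1` and `-i` on the eigenspaces of `pairMat` for `1` and
  -- `-1`.
  ((1 - Complex.I) / 2) • (1 : Matrix I I ℂ) + ((1 + Complex.I) / 2) • P.pairMat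

/-- The inverse of `sqrtMat`. -/
noncomputable def sqrtInv : Matrix I I ℂ :=
  ((1 + Complex.I) / 2) • (1 : Matrix I I ℂ) + ((1 - Complex.I) / 2) • P.pairMat

theorem pairMat_mul_self : P.pairMat * P.pairMat = 1 := by
  ext i j
  simp [pairMat, Matrix.mul_apply, Matrix.one_apply, P.inv_inv]

omit [Fintype I] in
theorem pairMat_transpose : P.pairMat.transpose = P.pairMat := by
  ext i j
  simp only [pairMat, Matrix.transpose_apply, Matrix.of_apply]
  exact if_congr (by rw [← P.inv_eq_iff, eq_comm]) rfl rfl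

omit [Fintype I] in
theorem sqrtMat_transpose : P.sqrtMat.transpose = P.sqrtMat := by
  simp [sqrtMat, pairMat_transpose]

omit [Fintype I] in
theorem sqrtInv_transpose : P.sqrtInv.transpose = P.sqrtInv := by
  simp [sqrtInv, pairMat_transpose]

theorem linear_pairMat_mul (a b c d : ℂ) :
    (a • (1 : Matrix I I ℂ) + b • P.pairMat) * (c • (1 : Matrix I I ℂ) + d • P.pairMat)
      = (a * c + b * d) • (1 : Matrix I I ℂ) + (a * d + b * c) • P.pairMat := by
  simp only [add_mul, mul_add, Matrix.smul_mul, Matrix.mul_smul, one_mul, mul_one,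
    pairMat_mul_self, smul_smul]
  module

theorem sqrtMat_mul_self : P.sqrtMat * P.sqrtMat = P.pairMat := by
  rw [sqrtMat, linear_pairMat_mul]
  have h1 : (1 - Complex.I) / 2 * ((1 - Complex.I) / 2) +
      (1 + Complex.I) / 2 * ((1 + Complex.I) / 2) = 0 := by
    linear_combination (1 / 2 : ℂ) * Complex.I_mul_I
  have h2 : (1 - Complex.I) / 2 * ((1 + Complex.I) / 2) +
      (1 + Complex.I) / 2 * ((1 - Complex.I) / 2) = 1 := by
    linear_combination (-1 / 2 : ℂ) * Complex.I_mul_I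
  rw [h1, h2, zero_smul, one_smul, zero_add]

theorem sqrtMat_mul_pairMat : P.sqrtMat * P.pairMat = P.sqrtInv := by
  rw [sqrtMat, sqrtInv, add_mul, Matrix.smul_mul, Matrix.smul_mul, pairMat_mul_self, one_mul,
    add_comm]

theorem pairMat_mul_sqrtMat : P.pairMat * P.sqrtMat = P.sqrtInv := by
  rw [sqrtMat, sqrtInv, mul_add, Matrix.mul_smul, Matrix.mul_smul, pairMat_mul_self, mul_one,
    add_comm]

theorem sqrtMat_mul_sqrtInv : P.sqrtMat * P.sqrtInv = 1 := by
  rw [← sqrtMat_mul_pairMat, ← mul_assoc, sqrtMat_mul_self, pairMat_mul_self]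

theorem sqrtInv_mul_sqrtMat : P.sqrtInv * P.sqrtMat = 1 := by
  rw [← pairMat_mul_sqrtMat, mul_assoc, sqrtMat_mul_self, pairMat_mul_self]

section

variable {B : Type*} [Ring B] [Algebra ℂ B]

theorem scalarMat_pairMat_mul (M : Matrix I I B) (i j : I) :
    (scalarMat B P.pairMat * M) i j = M (P.inv i) j := by
  simp [Matrix.mul_apply, scalarMat, pairMat, apply_ite (algebraMap ℂ B), ← P.inv_eq_iff]

theorem mul_scalarMat_pairMat (M : Matrix I I B) (i j : I) :
    (M * scalarMat B P.pairMat) i j = M i (P.inv j) := by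
  simp [Matrix.mul_apply, scalarMat, pairMat, apply_ite (algebraMap ℂ B)]

/-- The relations, in terms of matrices. -/
theorem rel_iff (V : Matrix I I B) : P.Rel V ↔
    V * scalarMat B P.pairMat * V.transpose = scalarMat B P.pairMat ∧
    V.transpose * scalarMat B P.pairMat * V = scalarMat B P.pairMat := by
  have hJ : ∀ i k, scalarMat B P.pairMat i k = if i = P.inv k then 1 else 0 := fun i k => by
    simp [scalarMat, pairMat, apply_ite (algebraMap ℂ B)]
  have h1 : ∀ i k, (V * scalarMat B P.pairMat * V.transpose) i k
      = ∑ j, V i j * V k (P.inv j) := fun i k => by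
    rw [Matrix.mul_apply, ← P.sum_inv]
    simp only [mul_scalarMat_pairMat, P.inv_inv, Matrix.transpose_apply]
  have h2 : ∀ i k, (V.transpose * scalarMat B P.pairMat * V) i k
      = ∑ j, V j i * V (P.inv j) k := fun i k => by
    rw [Matrix.mul_apply, ← P.sum_inv]
    simp only [mul_scalarMat_pairMat, P.inv_inv, Matrix.transpose_apply]
  simp only [← Matrix.ext_iff, h1, h2, hJ]
  exact ⟨fun h => ⟨h.row, h.col⟩, fun h => ⟨h.1, h.2⟩⟩

/-- The change of generators from the symmetric to the hyperbolic form. -/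
noncomputable def toPair (U : Matrix I I B) : Matrix I I B :=
  scalarMat B P.sqrtMat * U * scalarMat B P.sqrtInv

/-- The change of generators from the hyperbolic to the symmetric form. -/
noncomputable def ofPair (V : Matrix I I B) : Matrix I I B :=
  scalarMat B P.sqrtInv * V * scalarMat B P.sqrtMat

theorem scalarMat_mul_cancel {C D : Matrix I I ℂ} (h : C * D = 1) (M : Matrix I I B) :
    scalarMat B C * (scalarMat B D * M) = M := by
  rw [← mul_assoc, scalarMat_mul, h, scalarMat_one, one_mul]

theorem toPair_ofPair (V : Matrix I I B) : P.toPair (P.ofPair V) = V := by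
  simp only [toPair, ofPair, mul_assoc]
  rw [scalarMat_mul_cancel (sqrtMat_mul_sqrtInv P), scalarMat_mul, sqrtMat_mul_sqrtInv,
    scalarMat_one, mul_one]

theorem ofPair_toPair (V : Matrix I I B) : P.ofPair (P.toPair V) = V := by
  simp only [toPair, ofPair, mul_assoc]
  rw [scalarMat_mul_cancel (sqrtInv_mul_sqrtMat P), scalarMat_mul, sqrtInv_mul_sqrtMat,
    scalarMat_one, mul_one]

theorem toPair_transpose (U : Matrix I I B) :
    (P.toPair U).transpose = P.ofPair U.transpose := by
  simp only [toPair, ofPair, transpose_scalarMat_mul, transpose_mul_scalarMat, sqrtMat_transpose,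
    sqrtInv_transpose, mul_assoc]

theorem ofPair_transpose (U : Matrix I I B) :
    (P.ofPair U).transpose = P.toPair U.transpose := by
  simp only [toPair, ofPair, transpose_scalarMat_mul, transpose_mul_scalarMat, sqrtMat_transpose,
    sqrtInv_transpose, mul_assoc]

theorem ofPair_mul_ofPair (M N : Matrix I I B) : P.ofPair M * P.ofPair N = P.ofPair (M * N) := by
  simp only [ofPair, mul_assoc]
  rw [scalarMat_mul_cancel (sqrtMat_mul_sqrtInv P)]

theorem ofPair_one : P.ofPair (1 : Matrix I I B) = 1 := by
  rw [ofPair, mul_one, scalarMat_mul, sqrtInv_mul_sqrtMat, scalarMat_one]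

theorem ofPair_add (M N : Matrix I I B) : P.ofPair (M + N) = P.ofPair M + P.ofPair N := by
  simp only [ofPair, mul_add, add_mul]

theorem ofPair_sub (M N : Matrix I I B) : P.ofPair (M - N) = P.ofPair M - P.ofPair N := by
  simp only [ofPair, mul_sub, sub_mul]

theorem ofPair_smul (b : B) (M : Matrix I I B) : P.ofPair (b • M) = b • P.ofPair M := by
  simp only [ofPair, scalarMat_mul_smul, Matrix.smul_mul]

theorem toPair_eq (M : Matrix I I B) :
    P.toPair M = scalarMat B P.pairMat * P.ofPair M * scalarMat B P.pairMat := by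
  simp only [toPair, ofPair, ← mul_assoc]
  rw [scalarMat_mul, mul_assoc (_ * _), scalarMat_mul, sqrtMat_mul_pairMat,
    ← pairMat_mul_sqrtMat, ← mul_assoc, pairMat_mul_self, one_mul]

theorem pairMat_mul_toPair (M : Matrix I I B) :
    scalarMat B P.pairMat * P.toPair M = P.ofPair M * scalarMat B P.pairMat := by
  rw [toPair_eq, mul_assoc, scalarMat_mul_cancel (pairMat_mul_self P)]

theorem pairMat_mul_ofPair (M : Matrix I I B) :
    scalarMat B P.pairMat * P.ofPair M = P.toPair M * scalarMat B P.pairMat := by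
  rw [toPair_eq, mul_assoc (_ * _), scalarMat_mul, pairMat_mul_self, scalarMat_one, mul_one]

/-- With `S` symmetric and `S² = J`, one has `(S U S⁻¹) J (S U S⁻¹)ᵗ = S U Uᵗ S = J`, and likewise
for columns. -/
theorem rel_toPair {U : Matrix I I B} (h1 : U * U.transpose = 1) (h2 : U.transpose * U = 1) :
    P.Rel (P.toPair U) := by
  rw [rel_iff, toPair_transpose]
  constructor
  · rw [mul_assoc, pairMat_mul_ofPair, ← mul_assoc]
    have : P.toPair U * P.toPair U.transpose = 1 := by
      simp only [toPair, mul_assoc]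
      rw [scalarMat_mul_cancel (sqrtInv_mul_sqrtMat P), ← mul_assoc U, h1, one_mul, scalarMat_mul,
        sqrtMat_mul_sqrtInv, scalarMat_one]
    rw [this, one_mul]
  · rw [mul_assoc, pairMat_mul_toPair, ← mul_assoc, ofPair_mul_ofPair, h2, ofPair_one, one_mul]

theorem ofPair_mul_transpose {V : Matrix I I B} (h : P.Rel V) :
    P.ofPair V * (P.ofPair V).transpose = 1 ∧ (P.ofPair V).transpose * P.ofPair V = 1 := by
  obtain ⟨h1, h2⟩ := (P.rel_iff V).1 h
  have hJ : scalarMat B P.pairMat * scalarMat B P.pairMat = 1 := by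
    rw [scalarMat_mul, pairMat_mul_self, scalarMat_one]
  rw [ofPair_transpose, toPair_eq]
  have hc : scalarMat B P.pairMat * scalarMat B P.sqrtInv
      = scalarMat B P.sqrtInv * scalarMat B P.pairMat := by
    rw [scalarMat_mul, scalarMat_mul, ← sqrtMat_mul_pairMat, ← mul_assoc, pairMat_mul_sqrtMat,
      sqrtMat_mul_pairMat]
  have hc' : scalarMat B P.pairMat * scalarMat B P.sqrtMat
      = scalarMat B P.sqrtMat * scalarMat B P.pairMat := by
    rw [scalarMat_mul, scalarMat_mul, pairMat_mul_sqrtMat, sqrtMat_mul_pairMat]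
  have key : ∀ M : Matrix I I B, scalarMat B P.pairMat * P.ofPair M * scalarMat B P.pairMat
      = P.ofPair (scalarMat B P.pairMat * M * scalarMat B P.pairMat) := fun M => by
    simp only [ofPair, ← mul_assoc, hc]
    simp only [mul_assoc, hc']
  rw [key, ofPair_mul_ofPair, ofPair_mul_ofPair, ← mul_assoc, ← mul_assoc, h1, hJ, mul_assoc,
    mul_assoc, ← mul_assoc V.transpose, h2, hJ, ofPair_one]
  exact ⟨rfl, rfl⟩

theorem map_toPair {B' : Type*} [Ring B'] [Algebra ℂ B'] (f : B →ₐ[ℂ] B') (U : Matrix I I B) :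
    (P.toPair U).map f = P.toPair (U.map f) := by
  have h : ∀ M N : Matrix I I B, (M * N).map f = M.map f * N.map f := fun M N =>
    Matrix.map_mul (f := (f : B →+* B'))
  rw [toPair, h, h, map_scalarMat, map_scalarMat, toPair]

end

end IndexPairing

/-! ### Normal forms in `A_o(n)` and the kernel of `φ₂`. -/

namespace Ao

open IndexPairing

variable {n : ℕ}

/-- The matrix of the generators. -/
noncomputable def uMat (n : ℕ) : Matrix (Fin n) (Fin n) (Ao n) := Matrix.of u

theorem uMat_mul_transpose : uMat n * (uMat n).transpose = 1 := by
  ext i k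
  simp [Matrix.mul_apply, uMat, row_rel, Matrix.one_apply]

theorem transpose_mul_uMat : (uMat n).transpose * uMat n = 1 := by
  ext i k
  simp [Matrix.mul_apply, uMat, col_rel, Matrix.one_apply]

theorem scalarMat_conj_mem {B : Type*} [Ring B] [Algebra ℂ B] {S : Subalgebra ℂ B}
    (C D : Matrix (Fin n) (Fin n) ℂ)
    {M : Matrix (Fin n) (Fin n) B} (h : ∀ i j, M i j ∈ S) (i j : Fin n) :
    (scalarMat B C * M * scalarMat B D) i j ∈ S := by
  simp only [Matrix.mul_apply, scalarMat, Matrix.map_apply]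
  exact sum_mem fun _ _ => mul_mem (sum_mem fun _ _ => mul_mem (S.algebraMap_mem _) (h _ _))
    (S.algebraMap_mem _)

/-- The representation of `A_o(n)` on the normal words. -/
noncomputable def rep (P : IndexPairing (Fin n)) : Ao n →ₐ[ℂ] (Module.End ℂ P.normalSpan)ᵐᵒᵖ :=
  lift (P.ofPair P.opMul)
    (fun i k => by
      have := congrFun (congrFun (P.ofPair_mul_transpose rel_opMul).1 i) k
      simpa only [Matrix.mul_apply, Matrix.transpose_apply, Matrix.one_apply] using this)
    (fun i k => by
      have := congrFun (congrFun (P.ofPair_mul_transpose rel_opMul).2 i) k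
      simpa only [Matrix.mul_apply, Matrix.transpose_apply, Matrix.one_apply] using this)

/-- The presentation of `A_o(n)` by generators adapted to a hyperbolic form. -/
noncomputable def presentation (P : IndexPairing (Fin n)) : P.Presentation (P.toPair (uMat n)) where
  rel := P.rel_toPair uMat_mul_transpose transpose_mul_uMat
  adjoin_eq_top := by
    have hu : ∀ i j, (u i j : Ao n) ∈
        Algebra.adjoin ℂ {a | ∃ p q, P.toPair (uMat n) p q = a} := fun i j => by
      have : (u i j : Ao n) = P.ofPair (P.toPair (uMat n)) i j := by
        rw [P.ofPair_toPair]; rfl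
      rw [this]
      refine scalarMat_conj_mem _ _ (fun p q => Algebra.subset_adjoin ?_) i j
      exact ⟨p, q, rfl⟩
    refine Algebra.eq_top_iff.2 fun a => ?_
    induction a using Ao.induction with
    | hs c => exact Subalgebra.algebraMap_mem _ c
    | hu i j => exact hu i j
    | hm a b h1 h2 => exact mul_mem h1 h2
    | ha a b h1 h2 => exact add_mem h1 h2
  rep := rep P
  rep_gen p q := by
    have h : (uMat n).map (rep P) = P.ofPair P.opMul := by
      ext i j : 2
      exact lift_u _ _ _ i j
    have := congrFun (congrFun (P.map_toPair (rep P) (uMat n)) p) q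
    rw [h] at this
    exact this.trans (congrFun (congrFun (P.toPair_ofPair P.opMul) p) q)

/-- The pairing of the indices by the transposition of the first two. -/
def pairing (hn : 2 ≤ n) : IndexPairing (Fin n) where
  inv := Equiv.swap (⟨0, by omega⟩ : Fin n) ⟨1, by omega⟩
  inv_inv := Equiv.swap_apply_self _ _
  bot := ⟨0, by omega⟩
  inv_bot_ne := by rw [Equiv.swap_apply_left]; simp [Fin.ext_iff]

/-- The solutions of the equations that describe the kernel of `φ₂`. -/
theorem exists_eq_smul_sub (hn : 2 ≤ n) {X : Matrix (Fin n) (Fin n) (Ao n)}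
    (h : X + X.transpose * uMat n = 0) : ∃ b : Ao n, X = b • (uMat n - 1) := by
  let P := pairing hn
  let D := presentation P
  have hfin : ∃ d, ∀ i k, P.toPair X i k ∈ D.filt d := by
    choose d hd using fun p : Fin n × Fin n => D.exists_mem_filt (P.toPair X p.1 p.2)
    exact ⟨Finset.univ.sup d, fun i k =>
      D.filt_mono (Finset.le_sup (f := d) (Finset.mem_univ (i, k))) (hd (i, k))⟩
  obtain ⟨d, hd⟩ := hfin
  -- Up to a right factor `J`, this is `ofPair` applied to `X + Xᵗu`.
  have hker : scalarMat (Ao n) P.pairMat * P.toPair X +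
      (P.toPair X).transpose * scalarMat (Ao n) P.pairMat * P.toPair (uMat n) = 0 := by
    rw [mul_assoc, pairMat_mul_toPair, pairMat_mul_toPair, toPair_transpose, ← mul_assoc,
      ofPair_mul_ofPair, ← add_mul, ← ofPair_add, h]
    simp [ofPair]
  obtain ⟨b, hb⟩ := D.exists_eq_mul_sub d (P.toPair X) hd fun k j => by
    have := congrFun (congrFun hker k) j
    rw [Matrix.add_apply, scalarMat_pairMat_mul, Matrix.mul_apply, ← P.sum_inv] at this
    simpa only [mul_scalarMat_pairMat, P.inv_inv, Matrix.transpose_apply, Matrix.zero_apply] using this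
  refine ⟨b, ?_⟩
  have hb' : P.toPair X = b • (P.toPair (uMat n) - 1) := by
    ext i k
    rw [hb]
    simp [Matrix.one_apply, mul_sub]
  rw [← P.ofPair_toPair X, hb', ofPair_smul, ofPair_sub, ofPair_toPair, ofPair_one]

theorem eq_zero_of_smul_sub_eq_zero (hn : 2 ≤ n) {b : Ao n} (h : b • (uMat n - 1) = 0) : b = 0 := by
  let P := pairing hn
  refine (presentation P).eq_zero_of_mul_gen_eq P.top_ne_bot ?_
  have h1 : P.toPair (b • (uMat n - 1)) = b • (P.toPair (uMat n) - 1) := by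
    rw [toPair, scalarMat_mul_smul, Matrix.smul_mul, mul_sub, sub_mul, mul_one, scalarMat_mul,
      sqrtMat_mul_sqrtInv, scalarMat_one, toPair]
  have h2 := congrFun (congrFun h1 P.top) P.top
  rw [h] at h2
  simp only [toPair, mul_zero, zero_mul, Matrix.smul_apply, Matrix.sub_apply, Matrix.one_apply_eq,
    smul_eq_mul, mul_sub, mul_one, Matrix.zero_apply] at h2
  exact (sub_eq_zero.1 h2.symm)

end Ao

/-! ### The maps in coordinates and exactness at the left end. -/

namespace Ao

variable {n : ℕ}

/-- The coefficients of an element of `M_n A_o(n)` with respect to the matrix units. -/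
noncomputable def entries (x : MatAo n) : Matrix (Fin n) (Fin n) (Ao n) :=
  Matrix.of fun i j => (matBasis n).repr x (i, j)

theorem entries_injective : Function.Injective (entries (n := n)) := fun _ _ h =>
  (matBasis n).repr.injective (Finsupp.ext fun p => congrFun (congrFun h p.1) p.2)

theorem te_eq_smul (a : Ao n) (i j : Fin n) : te a i j = a • matBasis n (i, j) := by
  rw [matBasis_apply, te, te, TensorProduct.smul_tmul', smul_eq_mul, mul_one]

theorem entries_te (a : Ao n) (i j k l : Fin n) :
    entries (te a i j) k l = if i = k ∧ j = l then a else 0 := by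
  rw [entries, Matrix.of_apply, te_eq_smul, map_smul, Module.Basis.repr_self]
  simp [Finsupp.single_apply]

theorem entries_add (x y : MatAo n) : entries (x + y) = entries x + entries y := by
  ext; simp [entries]

theorem entries_zero : entries (0 : MatAo n) = 0 := by
  ext; simp [entries]

theorem entries_smul (a : Ao n) (x : MatAo n) : entries (a • x) = a • entries x := by
  ext; simp [entries]

theorem entries_sum {ι : Type*} (s : Finset ι) (f : ι → MatAo n) :
    entries (∑ i ∈ s, f i) = ∑ i ∈ s, entries (f i) :=
  map_sum (⟨⟨entries, entries_zero⟩, entries_add⟩ : MatAo n →+ Matrix (Fin n) (Fin n) (Ao n)) f s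

theorem sum_entries_smul (x : MatAo n) :
    ∑ i, ∑ k, entries x i k • matBasis n (i, k) = x := by
  rw [← Fintype.sum_prod_type']
  exact (matBasis n).sum_repr x

theorem entries_φ₁ (b : Ao n) : entries (φ₁ n b) = b • (uMat n - 1) := by
  rw [φ₁, LinearMap.toSpanSingleton_apply, entries_smul]
  congr 1
  ext i j
  simp only [entries_sum, Matrix.sum_apply, entries_te, ite_and]
  simp [du, uMat, Matrix.one_apply]

theorem entries_r (i k p q : Fin n) :
    entries (r i k) p q = (if i = p ∧ k = q then 1 else 0) + if k = p then u i q else 0 := by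
  rw [r, entries_add, entries_sum, Matrix.add_apply, Matrix.sum_apply, entries_te]
  simp [entries_te, ite_and]

theorem entries_φ₂ (x : MatAo n) :
    entries (φ₂ n x) = entries x + (entries x).transpose * uMat n := by
  conv_lhs => rw [← sum_entries_smul x]
  ext p q
  simp only [map_sum, map_smul, φ₂, Module.Basis.constr_basis, entries_sum, Matrix.sum_apply,
    entries_smul, Matrix.smul_apply, entries_r, smul_eq_mul, mul_add, Finset.sum_add_distrib,
    Matrix.add_apply, Matrix.mul_apply, Matrix.transpose_apply]
  congr 1
  · simp [ite_and]
  · simp [uMat]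

theorem φ₃_eq_sum (x : MatAo n) : φ₃ n x = ∑ i, ∑ k, entries x i k * du i k := by
  conv_lhs => rw [← sum_entries_smul x]
  simp [φ₃]

theorem injective_φ₁ (hn : 2 ≤ n) : Function.Injective (φ₁ n) := by
  refine (injective_iff_map_eq_zero _).2 fun b hb => eq_zero_of_smul_sub_eq_zero hn ?_
  rw [← entries_φ₁, hb, entries_zero]

theorem exact_φ₁_φ₂ (hn : 2 ≤ n) : Function.Exact (φ₁ n) (φ₂ n) := by
  intro x
  constructor
  · intro hx
    obtain ⟨b, hb⟩ := exists_eq_smul_sub hn (X := entries x) (by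
      rw [← entries_φ₂, hx, entries_zero])
    exact ⟨b, entries_injective (by rw [entries_φ₁, hb])⟩
  · rintro ⟨b, rfl⟩
    -- The composite vanishes since `(u - 1) + (uᵗ - 1)u = u - 1 + 1 - u`.
    apply entries_injective
    have : (b • (uMat n - 1)).transpose = b • ((uMat n).transpose - 1) := by
      rw [Matrix.transpose_smul, Matrix.transpose_sub, Matrix.transpose_one]
    rw [entries_φ₂, entries_φ₁, this, Matrix.smul_mul, ← smul_add, sub_mul, transpose_mul_uMat,
      one_mul, entries_zero, sub_add_sub_cancel', sub_self, smul_zero]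

/-! ### The universal derivation and exactness at the domain of `φ₃`. -/

section cokernel

variable (n)

noncomputable instance instAddCommGroupMatAo : AddCommGroup (MatAo n) :=
  TensorProduct.addCommGroup

noncomputable instance instHasQuotientMatAo : HasQuotient (MatAo n) (Submodule (Ao n) (MatAo n)) :=
  Submodule.hasQuotient

/-- The cokernel of `φ₂`. -/
def CokerPhi : Type := MatAo n ⧸ LinearMap.range (φ₂ n)

noncomputable instance : AddCommGroup (CokerPhi n) :=
  Submodule.Quotient.addCommGroup (LinearMap.range (φ₂ n))

noncomputable instance : Module (Ao n) (CokerPhi n) :=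
  Submodule.Quotient.module (LinearMap.range (φ₂ n))

noncomputable instance : Module ℂ (CokerPhi n) := Module.compHom _ (algebraMap ℂ (Ao n))

instance : IsScalarTower ℂ (Ao n) (CokerPhi n) where
  smul_assoc c a m := by
    rw [Algebra.smul_def, mul_smul]
    rfl

instance : SMulCommClass ℂ (Ao n) (CokerPhi n) := IsScalarTower.to_smulCommClass

/-- The projection onto the cokernel of `φ₂`. -/
noncomputable def toCoker : MatAo n →ₗ[Ao n] CokerPhi n := Submodule.mkQ (LinearMap.range (φ₂ n))

theorem toCoker_eq_zero_iff (x : MatAo n) : toCoker n x = 0 ↔ x ∈ LinearMap.range (φ₂ n) :=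
  Submodule.Quotient.mk_eq_zero _

theorem toCoker_te (a : Ao n) (i j : Fin n) : toCoker n (te a i j) = a • toCoker n (te 1 i j) := by
  rw [← map_smul, te_eq_smul, te_eq_smul 1, one_smul]

/-- The endomorphism of `CokerPhi n × ℂ` that encodes the value of a derivation on a generator. -/
noncomputable def derivGen (i j : Fin n) : Module.End ℂ (CokerPhi n × ℂ) :=
  LinearMap.prod
    ((Algebra.lsmul ℂ ℂ (CokerPhi n) (u i j : Ao n)).comp (LinearMap.fst ℂ _ _) +
      (LinearMap.toSpanSingleton ℂ (CokerPhi n) (toCoker n (te 1 i j))).comp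
        (LinearMap.snd ℂ _ _))
    ((if i = j then (1 : ℂ) else 0) • LinearMap.snd ℂ _ _)

theorem derivGen_apply (i j : Fin n) (m : CokerPhi n) (c : ℂ) :
    derivGen n i j (m, c) = ((u i j : Ao n) • m + c • toCoker n (te 1 i j),
      if i = j then c else 0) := by
  by_cases h : i = j <;> simp [derivGen, h]

/-- This is the vanishing of the class of `r i k`, that is, the derivative of a row relation. -/
theorem sum_smul_toCoker_row (i k : Fin n) :
    ∑ j, (u i j : Ao n) • toCoker n (te 1 k j)
      = - toCoker n (te 1 i k) := by
  have h : toCoker n (r i k) = 0 := (toCoker_eq_zero_iff n _).2 ⟨te 1 i k, φ₂_te i k⟩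
  rw [r, map_add, map_sum] at h
  exact (Finset.sum_congr rfl fun j _ => (toCoker_te n _ _ _).symm).trans
    (eq_neg_of_add_eq_zero_right h)

/-- Multiplying the row identities by `uᵗ` gives the column ones, so the column relations impose no
further condition on a derivation. -/
theorem sum_smul_toCoker_col (i k : Fin n) :
    ∑ j, (u j i : Ao n) • toCoker n (te 1 j k)
      = - toCoker n (te 1 k i) := by
  have h : ∀ j, toCoker n (te 1 j k) =
      - ∑ l, (u j l : Ao n) • toCoker n (te 1 k l) := fun j => by
    rw [sum_smul_toCoker_row, neg_neg]
  simp_rw [h, smul_neg, Finset.smul_sum, Finset.sum_neg_distrib, smul_smul]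
  rw [Finset.sum_comm]
  simp_rw [← Finset.sum_smul, col_rel]
  simp

/-- The action on `CokerPhi n × ℂ`, whose off-diagonal part is the universal derivation. -/
noncomputable def derivRep : Ao n →ₐ[ℂ] Module.End ℂ (CokerPhi n × ℂ) :=
  lift (derivGen n)
    (fun i k => by
      refine LinearMap.ext fun ⟨m, c⟩ => ?_
      simp only [LinearMap.sum_apply, Module.End.mul_apply, derivGen_apply, smul_add, smul_smul,
        smul_comm (u _ _ : Ao n) c]
      refine Prod.ext ?_ ?_
      · simp only [Prod.fst_sum, Finset.sum_add_distrib, ← Finset.sum_smul, row_rel,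
          ← Finset.smul_sum, sum_smul_toCoker_row]
        by_cases h : i = k <;> simp [h]
      · simp only [Prod.snd_sum]
        by_cases h : i = k <;> simp [h, eq_comm])
    (fun i k => by
      refine LinearMap.ext fun ⟨m, c⟩ => ?_
      simp only [LinearMap.sum_apply, Module.End.mul_apply, derivGen_apply, smul_add, smul_smul,
        smul_comm (u _ _ : Ao n) c]
      refine Prod.ext ?_ ?_
      · simp only [Prod.fst_sum, Finset.sum_add_distrib, ← Finset.sum_smul, col_rel,
          ← Finset.smul_sum, sum_smul_toCoker_col]
        by_cases h : i = k <;> simp [h]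
      · simp only [Prod.snd_sum]
        by_cases h : i = k <;> simp [h, eq_comm])

/-- The action is block triangular, with the module action and the counit on the diagonal. -/
theorem derivRep_apply (a : Ao n) : ∀ (m : CokerPhi n) (c : ℂ),
    derivRep n a (m, c) = (a • m + (derivRep n a (0, c)).1, counit n a * c) := by
  induction a using Ao.induction with
  | hs c => intro m d; simp [Module.algebraMap_end_apply]
  | hu i j =>
    intro m c
    simp only [derivRep, lift_u, derivGen_apply, counit_u]
    simp
  | hm a b h1 h2 =>
    intro m c
    simp only [map_mul, Module.End.mul_apply]
    rw [h2, h1, h2 0, h1 (b • 0 + _)]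
    simp [mul_smul, add_assoc, mul_assoc]
  | ha a b h1 h2 =>
    intro m c
    simp only [map_add, LinearMap.add_apply]
    rw [h1, h2]
    refine Prod.ext ?_ ?_
    · simp only [Prod.fst_add, add_smul]
      abel
    · simp [add_mul]

/-- The universal derivation. -/
noncomputable def deriv : Ao n →ₗ[ℂ] CokerPhi n :=
  LinearMap.fst ℂ _ _ ∘ₗ LinearMap.applyₗ (0, 1) ∘ₗ (derivRep n).toLinearMap

theorem deriv_apply (a : Ao n) : deriv n a = (derivRep n a (0, 1)).1 := rfl

/-- In the Leibniz rule `d(ab) = a d(b) + ε(b) d(a)` the last term drops out. -/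
theorem deriv_mul (a b : Ao n) (hb : counit n b = 0) : deriv n (a * b) = a • deriv n b := by
  rw [deriv_apply, map_mul, Module.End.mul_apply, derivRep_apply n b, hb, derivRep_apply n a]
  simp [deriv_apply, Prod.mk_zero_zero]

theorem deriv_du (i j : Fin n) : deriv n (du i j) = toCoker n (te 1 i j) := by
  have h1 : deriv n 1 = 0 := by simp [deriv_apply]
  rw [du, map_sub, apply_ite (deriv n), h1, map_zero, ite_self, sub_zero, deriv_apply, derivRep,
    lift_u, derivGen_apply]
  simp

theorem counit_du (i j : Fin n) : counit n (du i j) = 0 := by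
  simp [du, counit_u, apply_ite (counit n)]

theorem deriv_φ₃ (x : MatAo n) : deriv n (φ₃ n x) = toCoker n x := by
  have h : ∀ i k, deriv n (entries x i k * du i k)
      = toCoker n (entries x i k • matBasis n (i, k)) :=
    fun i k => by
      rw [deriv_mul n _ _ (counit_du n i k), deriv_du, map_smul, matBasis_apply]
  rw [φ₃_eq_sum]
  simp only [map_sum, h]
  simp only [← map_sum]
  rw [sum_entries_smul]

theorem exact_φ₂_φ₃ : Function.Exact (φ₂ n) (φ₃ n) := by
  intro x
  constructor
  · intro hx
    refine (toCoker_eq_zero_iff n x).1 ?_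
    rw [← deriv_φ₃, hx, map_zero]
  · rintro ⟨y, rfl⟩
    have h : φ₃ n ∘ₗ φ₂ n = 0 := by
      refine (matBasis n).ext fun p => ?_
      rw [LinearMap.comp_apply, matBasis_apply, φ₂_te, r, map_add, map_sum, φ₃_te]
      have h1 : ∀ j, φ₃ n (te (u p.1 j) p.2 j) = u p.1 j * du p.2 j := fun j => by
        rw [te_eq_smul, map_smul, matBasis_apply, φ₃_te, smul_eq_mul]
      simp_rw [h1, du, mul_sub, Finset.sum_sub_distrib, row_rel]
      simp
    exact LinearMap.congr_fun h y

end cokernel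

/-! ### The augmentation ideal and the end of the resolution. -/

theorem exact_φ₃_ε : Function.Exact (φ₃ n) (ε n) := by
  intro a
  constructor
  · intro ha
    have key : ∀ a : Ao n, a - algebraMap ℂ (Ao n) (counit n a) ∈ LinearMap.range (φ₃ n) := by
      intro a
      induction a using Ao.induction with
      | hs c => simp
      | hu i j =>
        refine ⟨te 1 i j, ?_⟩
        rw [φ₃_te, counit_u, du, apply_ite (algebraMap ℂ (Ao n)), map_one, map_zero]
      | hm a b h1 h2 =>
        -- The identity behind this is `ab - ε(ab) = a(b - ε(b)) + ε(b)(a - ε(a))`.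
        have := add_mem (Submodule.smul_mem _ a h2)
          (Submodule.smul_mem _ (algebraMap ℂ (Ao n) (counit n b)) h1)
        convert this using 1
        rw [smul_eq_mul, smul_eq_mul, map_mul, map_mul, mul_sub, mul_sub,
          Algebra.commutes (counit n b) a, Algebra.commutes (counit n b)]
        abel
      | ha a b h1 h2 =>
        have := add_mem h1 h2
        convert this using 1
        rw [map_add, map_add]
        abel
    have h := key a
    have h0 : counit n a = 0 := ha
    rwa [h0, map_zero, sub_zero] at h
  · rintro ⟨x, rfl⟩
    change counit n (φ₃ n x) = 0
    simp [φ₃_eq_sum, counit_du]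

theorem surjective_ε : Function.Surjective (ε n) := fun c =>
  ⟨algebraMap ℂ (Ao n) c, (counit n).commutes c⟩

end Ao

theorem theorem1 (n : ℕ) (hn : 2 ≤ n) :
    Module.Free (Ao n) (Ao n) ∧ Module.Free (Ao n) (Ao.MatAo n) ∧
    Function.Injective (Ao.φ₁ n) ∧
    Function.Exact (Ao.φ₁ n) (Ao.φ₂ n) ∧
    Function.Exact (Ao.φ₂ n) (Ao.φ₃ n) ∧
    Function.Exact (Ao.φ₃ n) (Ao.ε n) ∧
    Function.Surjective (Ao.ε n) :=
  ⟨inferInstance, Module.Free.of_basis (Ao.matBasis n), Ao.injective_φ₁ hn, Ao.exact_φ₁_φ₂ hn,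
    Ao.exact_φ₂_φ₃ n, Ao.exact_φ₃_ε, Ao.surjective_ε⟩
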